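/- Let $\mathcal T$ be the Toeplitz algebra, i.e. the universal unital $C^*$-algebra generated by one isometry $s$ ($s^*s=1$), let $u\in C(S^1)$ be the function $u(z)=z$, and let $\sigma:\mathcal T\to C(S^1)$ be the symbol map, i.e. the unital $*$-homomorphism with $\sigma(s)=u$. Let $\otimes$ denote the minimal (spatial) tensor product of $C^*$-algebras. For $i\in J:=\{0,1,2\}$ let $A_i$ be the triple tensor product with $C(S^1)$ as the factor at position $i$ and $\mathcal T$ as the two other factors (positions are numbered $0,1,2$): $$A_0=C(S^1)\otimes\mathcal T\otimes\mathcal T,\quad A_1=\mathcal T\otimes C(S^1)\otimes\mathcal T,\quad A_2=\mathcal T\otimes\mathcal T\otimes C(S^1).$$ For distinct $i,j\in J$ let $A_{ij}=A_{ji}$ be the triple tensor product with $C(S^1)$ at the positions $i$ and $j$ and $\mathcal T$ at the remaining position, and let $\pi^i_j:A_i\to A_{ij}$ be the surjective $*$-homomorphism given by $\sigma$ on the factor at position $j$ and by the identity on the two other factors. (The $C^*$-algebra $C(S^5_H)$ of the Heegaard odd quantum sphere is the multi-pullback of this family.) For distinct $i,j,k\in J$ put $A^i_{jk}:=A_i/(\ker\pi^i_j+\ker\pi^i_k)$,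 so that $A^i_{jk}=A^i_{kj}$, and write $[b]^i_{jk}$ for the class of $b\in A_i$. The map $$\pi^{ij}_k:A^i_{jk}\to A_{ij}/\pi^i_j(\ker\pi^i_k),\qquad [b]^i_{jk}\mapsto \pi^i_j(b)+\pi^i_j(\ker\pi^i_k),$$ is an isomorphism, since $\pi^i_j$ is surjective. Then the family $(\pi^i_j)_{i\neq j}$ satisfies the cocycle condition, i.e. for all distinct $i,j,k\in J$: 1. $\pi^i_j(\ker\pi^i_k)=\pi^j_i(\ker\pi^j_k)$; 2. the isomorphisms $\phi^{ij}_k:=(\pi^{ij}_k)^{-1}\circ\pi^{ji}_k:A^j_{ik}\to A^i_{jk}$, which are well defined by 1., satisfy $\phi^{ik}_j=\phi^{ij}_k\circ\phi^{jk}_i$. -/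

import Mathlib

open scoped ENNReal TensorProduct

noncomputable section

namespace HeegaardSphere

/-! ## Products of C*-algebras and *-homomorphisms -/

section CStarProduct

universe u v w

variable {I : Type u} {E : I → Type v} [∀ i, CStarAlgebra (E i)] [∀ i, Nontrivial (E i)]

/-- The C*-algebra of bounded families, with pointwise operations and the supremum norm. -/
def BoundedProduct (E : I → Type v) [∀ i, CStarAlgebra (E i)] [∀ i, Nontrivial (E i)] :
    Type (max u v) := lp E ∞

instance instCStarAlgebraLpInfty : CStarAlgebra (lp E ∞) where

instance instCStarAlgebraBoundedProduct : CStarAlgebra (BoundedProduct E) :=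
  inferInstanceAs (CStarAlgebra (lp E ∞))

namespace BoundedProduct

/-- A bounded family as an element of the product. -/
def mk (x : ∀ i, E i) (C : ℝ) (hC : ∀ i, ‖x i‖ ≤ C) : BoundedProduct E :=
  ⟨x, memℓp_infty ⟨C, by
    rintro _ ⟨i, rfl⟩
    exact hC i⟩⟩

/-- Evaluation of a bounded family at an index. -/
def eval (i : I) : BoundedProduct E →⋆ₐ[ℂ] E i where
  toFun x := x.1 i
  map_one' := rfl
  map_mul' _ _ := rfl
  map_zero' := rfl
  map_add' _ _ := rfl
  commutes' _ := rfl
  map_star' _ := rfl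

theorem eval_mk (x : ∀ i, E i) (C : ℝ) (hC : ∀ i, ‖x i‖ ≤ C) (i : I) :
    eval i (mk x C hC) = x i := rfl

theorem ext {x y : BoundedProduct E} (h : ∀ i, eval i x = eval i y) : x = y :=
  Subtype.ext (funext h)

theorem norm_eval_le (x : BoundedProduct E) (i : I) : ‖eval i x‖ ≤ ‖x‖ :=
  lp.norm_apply_le_norm ENNReal.top_ne_zero (show lp E ∞ from x) i

/-- The map of products `(x_i)_i ↦ (φ_{i'}(x_{g(i')}))_{i'}`. -/
def reindex {I' : Type w} {E' : I' → Type v} [∀ i, CStarAlgebra (E' i)] [∀ i, Nontrivial (E' i)]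
    (g : I' → I) (φ : ∀ i', E (g i') →⋆ₐ[ℂ] E' i') : BoundedProduct E →⋆ₐ[ℂ] BoundedProduct E' where
  toFun x := mk (fun i' => φ i' (eval (g i') x)) ‖x‖ (fun i' =>
    (NonUnitalStarAlgHom.norm_apply_le (φ i') _).trans (norm_eval_le x (g i')))
  map_one' := ext fun i' => (congrArg (φ i') (map_one (eval (g i')))).trans (map_one (φ i'))
  map_mul' x y := ext fun i' =>
    (congrArg (φ i') (map_mul (eval (g i')) x y)).trans (map_mul (φ i') _ _)
  map_zero' := ext fun i' => (congrArg (φ i') (map_zero (eval (g i')))).trans (map_zero (φ i'))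
  map_add' x y := ext fun i' =>
    (congrArg (φ i') (map_add (eval (g i')) x y)).trans (map_add (φ i') _ _)
  commutes' c := ext fun i' =>
    (congrArg (φ i') (AlgHomClass.commutes (eval (g i')) c)).trans (AlgHomClass.commutes (φ i') c)
  map_star' x := ext fun i' =>
    (congrArg (φ i') (map_star (eval (g i')) x)).trans (map_star (φ i') _)

theorem eval_reindex {I' : Type w} {E' : I' → Type v} [∀ i, CStarAlgebra (E' i)]
    [∀ i, Nontrivial (E' i)] (g : I' → I) (φ : ∀ i', E (g i') →⋆ₐ[ℂ] E' i') (x : BoundedProduct E)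
    (i' : I') : eval i' (reindex g φ x) = φ i' (eval (g i') x) := rfl

end BoundedProduct

end CStarProduct

section ClosedRange

universe u v

variable {A : Type u} {B : Type v} [CStarAlgebra A] [CStarAlgebra B]

theorem norm_starAlgHom_le (f : A →⋆ₐ[ℂ] B) (a : A) : ‖f a‖ ≤ ‖a‖ :=
  NonUnitalStarAlgHom.norm_apply_le f a

theorem continuous_starAlgHom (f : A →⋆ₐ[ℂ] B) : Continuous f :=
  AddMonoidHomClass.continuous_of_bound f 1 fun a => by
    simpa using norm_starAlgHom_le f a

theorem exists_selfAdjoint_lift (f : A →⋆ₐ[ℂ] B) (a : A) (h : IsSelfAdjoint (f a)) :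
    ∃ a', f a' = f a ∧ ‖a'‖ ≤ ‖f a‖ := by
  obtain ⟨a₀, ha₀, hfa⟩ : ∃ a₀, IsSelfAdjoint a₀ ∧ f a₀ = f a := by
    refine ⟨(realPart a : A), (realPart a).2, ?_⟩
    rw [realPart_apply_coe]
    have hs : star (f a) = f a := h
    have h2 : f ((2 : ℝ)⁻¹ • (a + star a)) = (2 : ℝ)⁻¹ • (f a + f (star a)) := by
      rw [← Complex.coe_smul, ← Complex.coe_smul, map_smul, map_add]
    rw [h2, map_star, hs, ← two_smul ℝ (f a), smul_smul]
    norm_num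
  set r : ℝ := ‖f a‖ with hr
  have hr0 : 0 ≤ r := norm_nonneg _
  let g : ℝ → ℝ := fun t => max (-r) (min r t)
  have hg : Continuous g := by fun_prop
  have hf := continuous_starAlgHom f
  refine ⟨cfc g a₀, ?_, ?_⟩
  · rw [StarAlgHomClass.map_cfc (S := ℂ) f g a₀ hg.continuousOn hf ha₀ (hfa ▸ h), hfa]
    conv_rhs => rw [← cfc_id ℝ (f a)]
    refine cfc_congr fun t ht => ?_
    have ht' : |t| ≤ r := by
      rcases subsingleton_or_nontrivial B with hB | hB
      · simp at ht
      · exact spectrum.norm_le_norm_of_mem ht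
    rw [abs_le] at ht'
    simp only [g, id]
    rw [min_eq_right ht'.2, max_eq_right ht'.1]
  · refine norm_cfc_le hr0 fun t _ => ?_
    rw [Real.norm_eq_abs, abs_le]
    exact ⟨le_max_left _ _, max_le (by linarith) (min_le_left _ _)⟩

/-- The image of a *-homomorphism of C*-algebras is closed. -/
theorem isClosed_range_starAlgHom (f : A →⋆ₐ[ℂ] B) : IsClosed (Set.range f) := by
  let F : NormedAddGroupHom A B :=
    { toFun := f
      map_add' := map_add f
      bound' := ⟨1, fun a => by simpa using norm_starAlgHom_le f a⟩ }
  have h1 : F.SurjectiveOnWith F.range 2 := by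
    rintro _ ⟨a, rfl⟩
    have hre : f (realPart a : A) = realPart (f a) := by
      rw [realPart_apply_coe, realPart_apply_coe, ← Complex.coe_smul, ← Complex.coe_smul, map_smul,
        map_add, map_star]
    have him : f (imaginaryPart a : A) = imaginaryPart (f a) := by
      rw [imaginaryPart_apply_coe, imaginaryPart_apply_coe, ← Complex.coe_smul, ← Complex.coe_smul,
        map_smul, map_smul, map_sub, map_star]
    obtain ⟨x, hx, hx'⟩ := exists_selfAdjoint_lift f (realPart a) (hre ▸ (realPart (f a)).2)
    obtain ⟨y, hy, hy'⟩ :=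
      exists_selfAdjoint_lift f (imaginaryPart a) (him ▸ (imaginaryPart (f a)).2)
    refine ⟨x + Complex.I • y, ?_, ?_⟩
    · change f (x + Complex.I • y) = f a
      rw [map_add, map_smul, hx, hy, ← map_smul, ← map_add, realPart_add_I_smul_imaginaryPart]
    · have h3 : ‖f (realPart a : A)‖ ≤ ‖f a‖ := by rw [hre]; exact realPart.norm_le (f a)
      have h4 : ‖f (imaginaryPart a : A)‖ ≤ ‖f a‖ := by
        rw [him]; exact imaginaryPart.norm_le (f a)
      calc ‖x + Complex.I • y‖ ≤ ‖x‖ + ‖Complex.I • y‖ := norm_add_le _ _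
        _ = ‖x‖ + ‖y‖ := by rw [norm_smul, Complex.norm_I, one_mul]
        _ ≤ 2 * ‖f a‖ := by linarith
  have h2 := (controlled_closure_of_complete two_pos one_pos h1).surjOn
  refine isClosed_of_closure_subset fun b hb => ?_
  obtain ⟨a, -, ha⟩ := h2 hb
  exact ⟨a, ha⟩

end ClosedRange

/-! ## The cocycle condition for a finite family of surjections -/

section Cocycle

universe u v

variable {A : Type u} {B : Type v} [CStarAlgebra A] [CStarAlgebra B]

instance instIsTwoSidedSup (P Q : Ideal A) [P.IsTwoSided] [Q.IsTwoSided] :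
    (P ⊔ Q).IsTwoSided := ⟨fun {a} b ha => by
  obtain ⟨p, hp, q, hq, rfl⟩ := Submodule.mem_sup.1 ha
  rw [add_mul]
  exact Submodule.add_mem_sup (P.mul_mem_right b hp) (Q.mul_mem_right b hq)⟩

/-- The image `f(Q)` of an ideal `Q` under a surjective *-homomorphism `f`. -/
def imageIdeal (f : A →⋆ₐ[ℂ] B) (hf : Function.Surjective f) (Q : Ideal A) : Ideal B where
  carrier := f '' Q
  zero_mem' := ⟨0, Q.zero_mem, map_zero f⟩
  add_mem' := by
    rintro _ _ ⟨a, ha, rfl⟩ ⟨b, hb, rfl⟩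
    exact ⟨a + b, Q.add_mem ha hb, map_add f a b⟩
  smul_mem' := by
    rintro c _ ⟨a, ha, rfl⟩
    obtain ⟨c, rfl⟩ := hf c
    exact ⟨c * a, Q.mul_mem_left c ha, map_mul f c a⟩

instance instIsTwoSidedImageIdeal (f : A →⋆ₐ[ℂ] B) (hf : Function.Surjective f) (Q : Ideal A)
    [Q.IsTwoSided] : (imageIdeal f hf Q).IsTwoSided := ⟨by
  rintro _ c ⟨a, ha, rfl⟩
  obtain ⟨c, rfl⟩ := hf c
  exact ⟨a * c, Q.mul_mem_right c ha, map_mul f a c⟩⟩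

/-- For a surjection `f : A → B` with kernel `P` and an ideal `Q` of `A`, the map
`A / (P + Q) → B / f(Q)`, `a + (P + Q) ↦ f(a) + f(Q)`. -/
def quotientHom (f : A →⋆ₐ[ℂ] B) (hf : Function.Surjective f) (P Q : Ideal A) [P.IsTwoSided]
    [Q.IsTwoSided] (hP : P = RingHom.ker f) :
    (A ⧸ (P ⊔ Q)) →ₐ[ℂ] (B ⧸ imageIdeal f hf Q) :=
  Ideal.Quotient.liftₐ (P ⊔ Q) ((Ideal.Quotient.mkₐ ℂ (imageIdeal f hf Q)).comp f.toAlgHom)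
    (fun a ha => by
      obtain ⟨p, hp, q, hq, rfl⟩ := Submodule.mem_sup.1 ha
      rw [hP, RingHom.mem_ker] at hp
      refine Ideal.Quotient.eq_zero_iff_mem.2 ⟨q, hq, ?_⟩
      change f q = f (p + q)
      rw [map_add, hp, zero_add])

theorem quotientHom_bijective (f : A →⋆ₐ[ℂ] B) (hf : Function.Surjective f) (P Q : Ideal A)
    [P.IsTwoSided] [Q.IsTwoSided] (hP : P = RingHom.ker f) :
    Function.Bijective (quotientHom f hf P Q hP) := by
  constructor
  · rw [injective_iff_map_eq_zero]
    intro x hx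
    obtain ⟨a, rfl⟩ := Ideal.Quotient.mk_surjective x
    obtain ⟨q, hq, hqa⟩ := Ideal.Quotient.eq_zero_iff_mem.1
      (show Ideal.Quotient.mk (imageIdeal f hf Q) (f a) = 0 from hx)
    refine Ideal.Quotient.eq_zero_iff_mem.2 ?_
    rw [← sub_add_cancel a q]
    refine Submodule.add_mem_sup ?_ hq
    rw [hP, RingHom.mem_ker, map_sub, hqa, sub_self]
  · intro y
    obtain ⟨b, rfl⟩ := Ideal.Quotient.mk_surjective y
    obtain ⟨a, rfl⟩ := hf b
    exact ⟨Ideal.Quotient.mk _ a, rfl⟩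

/-- The map `quotientHom` as an isomorphism. -/
def quotientEquiv (f : A →⋆ₐ[ℂ] B) (hf : Function.Surjective f) (P Q : Ideal A) [P.IsTwoSided]
    [Q.IsTwoSided] (hP : P = RingHom.ker f) :
    (A ⧸ (P ⊔ Q)) ≃ₐ[ℂ] (B ⧸ imageIdeal f hf Q) :=
  AlgEquiv.ofBijective (quotientHom f hf P Q hP) (quotientHom_bijective f hf P Q hP)

/-- A finite family `(π^i_j : A_i → A_{ij})_{i ≠ j}` of surjective homomorphisms of unital
C*-algebras, where `A_{ij} = A_{ji}`. The targets are indexed by unordered pairs `e = {i, j}`, and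
`proj e i` is the map `π^i_j`, for `i ∈ e = {i, j}` with `i ≠ j`. -/
structure SurjectiveFamily (J : Type u) [Finite J] where
  /-- The algebras `A_i`. -/
  source : J → Type v
  /-- The algebras `A_{ij}`. -/
  target : Sym2 J → Type v
  [cstarSource : ∀ i, CStarAlgebra (source i)]
  [cstarTarget : ∀ e, CStarAlgebra (target e)]
  /-- The homomorphisms `π^i_j`. -/
  proj : ∀ (e : Sym2 J) (i : J), ¬ e.IsDiag → i ∈ e → source i →⋆ₐ[ℂ] target e
  surjective : ∀ (e : Sym2 J) (i : J) (he : ¬ e.IsDiag) (hi : i ∈ e),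
    Function.Surjective (proj e i he hi)

namespace SurjectiveFamily

attribute [instance] cstarSource cstarTarget

variable {J : Type u} [Finite J] (F : SurjectiveFamily.{u, v} J) {i j k : J}

/-- The map `π^i_j : A_i → A_{ij}`. -/
def projLeft (h : i ≠ j) : F.source i →⋆ₐ[ℂ] F.target s(i, j) :=
  F.proj s(i, j) i (by simpa using h) (Sym2.mem_mk_left i j)

/-- The map `π^j_i : A_j → A_{ji} = A_{ij}`. -/
def projRight (h : i ≠ j) : F.source j →⋆ₐ[ℂ] F.target s(i, j) :=
  F.proj s(i, j) j (by simpa using h) (Sym2.mem_mk_right i j)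

theorem surjective_projLeft (h : i ≠ j) : Function.Surjective (F.projLeft h) :=
  F.surjective _ _ _ _

theorem surjective_projRight (h : i ≠ j) : Function.Surjective (F.projRight h) :=
  F.surjective _ _ _ _

/-- The ideal `ker π^i_j` of `A_i`. -/
def kerProj (h : i ≠ j) : Ideal (F.source i) := RingHom.ker (F.projLeft h)

instance instIsTwoSidedKerProj (h : i ≠ j) : (F.kerProj h).IsTwoSided :=
  inferInstanceAs (RingHom.ker (F.projLeft h)).IsTwoSided

theorem kerProj_eq_ker_projRight (h : i ≠ j) :
    F.kerProj h.symm = RingHom.ker (F.projRight h) := by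
  have key : ∀ (e e' : Sym2 J) (_ : e = e') (he : ¬ e.IsDiag) (he' : ¬ e'.IsDiag)
      (hj : j ∈ e) (hj' : j ∈ e'),
      RingHom.ker (F.proj e j he hj) = RingHom.ker (F.proj e' j he' hj') := by
    rintro e _ rfl _ _ _ _
    rfl
  exact key _ _ Sym2.eq_swap _ _ _ _

/-- The quotient `A^i_{jk} = A_i / (ker π^i_j + ker π^i_k)`. -/
abbrev tripleQuotient (hij : i ≠ j) (hik : i ≠ k) : Type v :=
  F.source i ⧸ (F.kerProj hij ⊔ F.kerProj hik)

/-- The identification `A^i_{jk} = A^i_{kj}`, `[b]^i_{jk} ↦ [b]^i_{kj}`. -/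
def swap (hij : i ≠ j) (hik : i ≠ k) :
    F.tripleQuotient hij hik ≃ₐ[ℂ] F.tripleQuotient hik hij :=
  Ideal.quotientEquivAlgOfEq ℂ (sup_comm _ _)

/-- The ideal `π^i_j(ker π^i_k)` of `A_{ij}`. -/
def leftImage (hij : i ≠ j) (hik : i ≠ k) : Ideal (F.target s(i, j)) :=
  imageIdeal (F.projLeft hij) (F.surjective_projLeft hij) (F.kerProj hik)

/-- The ideal `π^j_i(ker π^j_k)` of `A_{ij}`. -/
def rightImage (hij : i ≠ j) (hjk : j ≠ k) : Ideal (F.target s(i, j)) :=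
  imageIdeal (F.projRight hij) (F.surjective_projRight hij) (F.kerProj hjk)

instance instIsTwoSidedLeftImage (hij : i ≠ j) (hik : i ≠ k) :
    (F.leftImage hij hik).IsTwoSided := instIsTwoSidedImageIdeal _ _ _

instance instIsTwoSidedRightImage (hij : i ≠ j) (hjk : j ≠ k) :
    (F.rightImage hij hjk).IsTwoSided := instIsTwoSidedImageIdeal _ _ _

/-- The isomorphism `π^{ij}_k : A^i_{jk} → A_{ij} / π^i_j(ker π^i_k)`. -/
def leftEquiv (hij : i ≠ j) (hik : i ≠ k) :
    F.tripleQuotient hij hik ≃ₐ[ℂ] (F.target s(i, j) ⧸ F.leftImage hij hik) :=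
  quotientEquiv (F.projLeft hij) (F.surjective_projLeft hij) (F.kerProj hij) (F.kerProj hik) rfl

/-- The isomorphism `π^{ji}_k : A^j_{ik} → A_{ij} / π^j_i(ker π^j_k)`. -/
def rightEquiv (hij : i ≠ j) (hjk : j ≠ k) :
    F.tripleQuotient hij.symm hjk ≃ₐ[ℂ] (F.target s(i, j) ⧸ F.rightImage hij hjk) :=
  quotientEquiv (F.projRight hij) (F.surjective_projRight hij) (F.kerProj hij.symm)
    (F.kerProj hjk) (F.kerProj_eq_ker_projRight hij)

/-- The isomorphism `φ^{ij}_k = (π^{ij}_k)⁻¹ ∘ π^{ji}_k : A^j_{ik} → A^i_{jk}`, which makes sense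
when `π^i_j(ker π^i_k) = π^j_i(ker π^j_k)`. -/
def transition (hij : i ≠ j) (hik : i ≠ k) (hjk : j ≠ k)
    (h : F.leftImage hij hik = F.rightImage hij hjk) :
    F.tripleQuotient hij.symm hjk ≃ₐ[ℂ] F.tripleQuotient hij hik :=
  (F.rightEquiv hij hjk).trans
    ((Ideal.quotientEquivAlgOfEq ℂ h.symm).trans (F.leftEquiv hij hik).symm)

/-- The cocycle condition: for all distinct `i`, `j`, `k`,
1. `π^i_j(ker π^i_k) = π^j_i(ker π^j_k)`;
2. `φ^{ik}_j = φ^{ij}_k ∘ φ^{jk}_i` (up to the identifications `A^l_{mn} = A^l_{nm}`). -/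
def CocycleCondition : Prop :=
  ∃ h : ∀ (i j k : J) (hij : i ≠ j) (hik : i ≠ k) (hjk : j ≠ k),
      F.leftImage hij hik = F.rightImage hij hjk,
    ∀ (i j k : J) (hij : i ≠ j) (hik : i ≠ k) (hjk : j ≠ k)
      (x : F.tripleQuotient hik.symm hjk.symm),
      F.swap hik hij (F.transition hik hij hjk.symm (h i k j hik hij hjk.symm) x) =
        F.transition hij hik hjk (h i j k hij hik hjk)
          (F.swap hjk hij.symm
            (F.transition hjk hij.symm hik.symm (h j k i hjk hij.symm hik.symm)
              (F.swap hik.symm hjk.symm x)))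

end SurjectiveFamily

end Cocycle

/-! ## The Toeplitz algebra and the symbol map -/

section Toeplitz

/-- An isometry `v` in a nonzero unital C*-algebra. A unital C*-algebra generated by one element is
separable, hence has at most the cardinality of the continuum, so that up to isomorphism every
C*-algebra generated by an isometry has its carrier in `Type`. -/
structure IsometryIn : Type 1 where
  carrier : Type
  [cstar : CStarAlgebra carrier]
  [nontrivial : Nontrivial carrier]
  v : carrier
  star_mul_self : star v * v = 1

attribute [instance] IsometryIn.cstar IsometryIn.nontrivial

/-- The family of all isometries, as an element of the product of the C*-algebras in which they
lie. -/
def universalIsometry : BoundedProduct (fun i : IsometryIn => i.carrier) :=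
  BoundedProduct.mk (fun i => i.v) 1 fun i => by
    have h : ‖i.v‖ * ‖i.v‖ = 1 := by
      rw [← CStarRing.norm_star_mul_self, i.star_mul_self, norm_one]
    nlinarith [norm_nonneg i.v]

/-- The Toeplitz algebra `𝒯`: the universal unital C*-algebra generated by one isometry, built as
the C*-algebra generated by the direct sum of all isometries. -/
def Toeplitz : Type 1 := StarAlgebra.elemental ℂ universalIsometry

instance instCStarAlgebraToeplitz : CStarAlgebra Toeplitz :=
  inferInstanceAs (CStarAlgebra (StarAlgebra.elemental ℂ universalIsometry))

namespace Toeplitz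

/-- The generating isometry of the Toeplitz algebra. -/
def s : Toeplitz := ⟨universalIsometry, StarAlgebra.elemental.self_mem ℂ _⟩

theorem star_s_mul_s : star s * s = 1 :=
  Subtype.ext (BoundedProduct.ext fun i : IsometryIn => i.star_mul_self)

/-- The unital *-homomorphism `𝒯 → A` with `s ↦ v`, for an isometry `v ∈ A`. -/
def lift {A : Type} [CStarAlgebra A] [Nontrivial A] (v : A) (hv : star v * v = 1) :
    Toeplitz →⋆ₐ[ℂ] A :=
  (BoundedProduct.eval (E := fun i : IsometryIn => i.carrier) ⟨A, v, hv⟩).comp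
    (StarAlgebra.elemental ℂ universalIsometry).subtype

theorem lift_s {A : Type} [CStarAlgebra A] [Nontrivial A] (v : A) (hv : star v * v = 1) :
    lift v hv s = v := rfl

/-- The universal property of the Toeplitz algebra. -/
theorem existsUnique_lift {A : Type} [CStarAlgebra A] [Nontrivial A] (v : A)
    (hv : star v * v = 1) : ∃! f : Toeplitz →⋆ₐ[ℂ] A, f s = v :=
  ⟨lift v hv, lift_s v hv, fun f hf => by
    refine StarAlgebra.elemental.starAlgHomClass_ext ℂ (a := universalIsometry) (φ := f)
      (ψ := lift v hv) (continuous_starAlgHom f) (continuous_starAlgHom _) ?_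
    exact hf⟩

end Toeplitz

/-- The unitary `u` generating the C*-algebra of continuous functions on the unit circle `S¹`, i.e.
the function `z ↦ z`. -/
def circleUnitary : C(Circle, ℂ) := ⟨fun z => (z : ℂ), continuous_subtype_val⟩

theorem star_circleUnitary_mul_self : star circleUnitary * circleUnitary = 1 := by
  ext z
  change (starRingEnd ℂ) (z : ℂ) * (z : ℂ) = 1
  rw [← Complex.normSq_eq_conj_mul_self, Circle.normSq_coe, Complex.ofReal_one]

/-- The C*-algebra `C(S¹)` of continuous complex functions on the unit circle (placed in the same
universe as the Toeplitz algebra). -/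
abbrev CircleAlgebra : Type 1 := C(ULift.{1} Circle, ℂ)

/-- The symbol map `σ : 𝒯 → C(S¹)`, `s ↦ u`. -/
def symbol : Toeplitz →⋆ₐ[ℂ] CircleAlgebra :=
  (ContinuousMap.compStarAlgHom' ℂ ℂ 
    (⟨ULift.down, continuous_uliftDown⟩ : C(ULift.{1} Circle, Circle))).comp
    (Toeplitz.lift circleUnitary star_circleUnitary_mul_self)

theorem symbol_s_apply (z : ULift.{1} Circle) : symbol Toeplitz.s z = (z.down : ℂ) := rfl

theorem symbol_surjective : Function.Surjective symbol := by
  have hcl : IsClosed (symbol.range : Set CircleAlgebra) := isClosed_range_starAlgHom symbol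
  have htop := ContinuousMap.starSubalgebra_topologicalClosure_eq_top_of_separatesPoints
    symbol.range (fun x y hxy => ⟨_, ⟨symbol Toeplitz.s, ⟨Toeplitz.s, rfl⟩, rfl⟩, fun h => hxy (by
      exact ULift.ext _ _ (Circle.ext h))⟩)
  intro g
  have hg : g ∈ symbol.range.topologicalClosure := htop ▸ StarSubalgebra.mem_top
  have hg' : g ∈ closure (symbol.range : Set CircleAlgebra) := hg
  rw [hcl.closure_eq] at hg'
  exact hg'

end Toeplitz

/-! ## The minimal (spatial) tensor product -/

section Tensor

universe u

/-- A unital *-representation of a C*-algebra on a nonzero Hilbert space. -/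
structure Representation (A : Type u) [CStarAlgebra A] : Type (u + 1) where
  space : Type u
  [normed : NormedAddCommGroup space]
  [inner : InnerProductSpace ℂ space]
  [complete : CompleteSpace space]
  [nontrivial : Nontrivial space]
  toHom : A →⋆ₐ[ℂ] (space →L[ℂ] space)

attribute [instance] Representation.normed Representation.inner Representation.complete
  Representation.nontrivial

/-- The pullback of a representation along a *-homomorphism. -/
def Representation.comp {A B : Type u} [CStarAlgebra A] [CStarAlgebra B] (ρ : Representation B)
    (f : A →⋆ₐ[ℂ] B) : Representation A where
  space := ρ.space
  toHom := ρ.toHom.comp f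

variable {A B C A' B' C' : Type u} [CStarAlgebra A] [CStarAlgebra B] [CStarAlgebra C]
  [CStarAlgebra A'] [CStarAlgebra B'] [CStarAlgebra C']

/-- The Hilbert space tensor product `H₁ ⊗ H₂ ⊗ H₃`: the completion of the algebraic one. -/
def HilbertTensor (H₁ H₂ H₃ : Type u) [NormedAddCommGroup H₁] [InnerProductSpace ℂ H₁]
    [NormedAddCommGroup H₂] [InnerProductSpace ℂ H₂] [NormedAddCommGroup H₃]
    [InnerProductSpace ℂ H₃] : Type u :=
  UniformSpace.Completion ((H₁ ⊗[ℂ] H₂) ⊗[ℂ] H₃)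

namespace HilbertTensor

variable {H₁ H₂ H₃ : Type u} [NormedAddCommGroup H₁] [InnerProductSpace ℂ H₁]
  [NormedAddCommGroup H₂] [InnerProductSpace ℂ H₂] [NormedAddCommGroup H₃]
  [InnerProductSpace ℂ H₃]

instance instNormedAddCommGroup : NormedAddCommGroup (HilbertTensor H₁ H₂ H₃) :=
  inferInstanceAs (NormedAddCommGroup (UniformSpace.Completion ((H₁ ⊗[ℂ] H₂) ⊗[ℂ] H₃)))

instance instInnerProductSpace : InnerProductSpace ℂ (HilbertTensor H₁ H₂ H₃) :=
  inferInstanceAs (InnerProductSpace ℂ (UniformSpace.Completion ((H₁ ⊗[ℂ] H₂) ⊗[ℂ] H₃)))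

instance instCompleteSpace : CompleteSpace (HilbertTensor H₁ H₂ H₃) :=
  inferInstanceAs (CompleteSpace (UniformSpace.Completion ((H₁ ⊗[ℂ] H₂) ⊗[ℂ] H₃)))

/-- The elementary tensor `x ⊗ y ⊗ z`. -/
def tmul (x : H₁) (y : H₂) (z : H₃) : HilbertTensor H₁ H₂ H₃ :=
  (((x ⊗ₜ[ℂ] y) ⊗ₜ[ℂ] z : (H₁ ⊗[ℂ] H₂) ⊗[ℂ] H₃) :
    UniformSpace.Completion ((H₁ ⊗[ℂ] H₂) ⊗[ℂ] H₃))

theorem norm_tmul (x : H₁) (y : H₂) (z : H₃) : ‖tmul x y z‖ = ‖x‖ * ‖y‖ * ‖z‖ := by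
  refine (UniformSpace.Completion.norm_coe _).trans ?_
  rw [TensorProduct.norm_tmul, TensorProduct.norm_tmul]

instance instNontrivial [Nontrivial H₁] [Nontrivial H₂] [Nontrivial H₃] :
    Nontrivial (HilbertTensor H₁ H₂ H₃) := by
  obtain ⟨x, hx⟩ := exists_ne (0 : H₁)
  obtain ⟨y, hy⟩ := exists_ne (0 : H₂)
  obtain ⟨z, hz⟩ := exists_ne (0 : H₃)
  refine ⟨tmul x y z, 0, ?_⟩
  rw [← norm_ne_zero_iff, norm_tmul]
  simp [hx, hy, hz]

/-- The operator `R ⊗ S ⊗ T` on `H₁ ⊗ H₂ ⊗ H₃`. -/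
def map (R : H₁ →L[ℂ] H₁) (S : H₂ →L[ℂ] H₂) (T : H₃ →L[ℂ] H₃) :
    HilbertTensor H₁ H₂ H₃ →L[ℂ] HilbertTensor H₁ H₂ H₃ :=
  (TensorProduct.mapL (TensorProduct.mapL R S) T).completion

theorem map_tmul (R : H₁ →L[ℂ] H₁) (S : H₂ →L[ℂ] H₂) (T : H₃ →L[ℂ] H₃) (x : H₁) (y : H₂)
    (z : H₃) : map R S T (tmul x y z) = tmul (R x) (S y) (T z) :=
  ContinuousLinearMap.completion_apply_coe _ _

theorem norm_completion_le {H : Type u} [NormedAddCommGroup H] [InnerProductSpace ℂ H]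
    (T : H →L[ℂ] H) : ‖T.completion‖ ≤ ‖T‖ := by
  refine ContinuousLinearMap.opNorm_le_bound _ (norm_nonneg _) fun x => ?_
  induction x using UniformSpace.Completion.induction_on with
  | hp => exact isClosed_le (by fun_prop) (by fun_prop)
  | ih x =>
    rw [ContinuousLinearMap.completion_apply_coe, UniformSpace.Completion.norm_coe,
      UniformSpace.Completion.norm_coe]
    exact T.le_opNorm x

theorem norm_map_le (R : H₁ →L[ℂ] H₁) (S : H₂ →L[ℂ] H₂) (T : H₃ →L[ℂ] H₃) :
    ‖map R S T‖ ≤ ‖R‖ * ‖S‖ * ‖T‖ := by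
  refine (norm_completion_le _).trans ((TensorProduct.norm_mapL_le _ _).trans ?_)
  gcongr
  exact TensorProduct.norm_mapL_le _ _

end HilbertTensor

/-- The C*-algebra of bounded operators on the Hilbert space `H₁ ⊗ H₂ ⊗ H₃`, where `H₁`, `H₂`, `H₃`
are the spaces of three representations. -/
def TensorOperators (r : Representation A × Representation B × Representation C) : Type u :=
  HilbertTensor r.1.space r.2.1.space r.2.2.space →L[ℂ]
    HilbertTensor r.1.space r.2.1.space r.2.2.space

instance instCStarAlgebraTensorOperators
    (r : Representation A × Representation B × Representation C) :
    CStarAlgebra (TensorOperators r) :=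
  inferInstanceAs (CStarAlgebra (HilbertTensor r.1.space r.2.1.space r.2.2.space →L[ℂ]
    HilbertTensor r.1.space r.2.1.space r.2.2.space))

instance instNontrivialTensorOperators
    (r : Representation A × Representation B × Representation C) :
    Nontrivial (TensorOperators r) :=
  inferInstanceAs (Nontrivial (HilbertTensor r.1.space r.2.1.space r.2.2.space →L[ℂ]
    HilbertTensor r.1.space r.2.1.space r.2.2.space))

/-- The operator `ρ₁(a) ⊗ ρ₂(b) ⊗ ρ₃(c)` on the Hilbert space `H₁ ⊗ H₂ ⊗ H₃`. -/
def tensorOperator (r : Representation A × Representation B × Representation C)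
    (a : A) (b : B) (c : C) : TensorOperators r :=
  HilbertTensor.map (r.1.toHom a) (r.2.1.toHom b) (r.2.2.toHom c)

theorem norm_tensorOperator_le (r : Representation A × Representation B × Representation C)
    (a : A) (b : B) (c : C) : ‖tensorOperator r a b c‖ ≤ ‖a‖ * ‖b‖ * ‖c‖ := by
  refine (HilbertTensor.norm_map_le _ _ _).trans ?_
  gcongr
  · exact norm_starAlgHom_le _ _
  · exact norm_starAlgHom_le _ _
  · exact norm_starAlgHom_le _ _

/-- The C*-algebra of bounded families of operators on the Hilbert spaces `H₁ ⊗ H₂ ⊗ H₃`, indexed by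
all triples of representations. -/
abbrev TensorAmbient (A B C : Type u) [CStarAlgebra A] [CStarAlgebra B] [CStarAlgebra C] :
    Type (u + 1) :=
  BoundedProduct fun r : Representation A × Representation B × Representation C =>
    TensorOperators r

/-- The family `ρ₁(a) ⊗ ρ₂(b) ⊗ ρ₃(c)`, indexed by all triples of representations. -/
def ambientTensor (a : A) (b : B) (c : C) : TensorAmbient A B C :=
  BoundedProduct.mk (fun r => tensorOperator r a b c) (‖a‖ * ‖b‖ * ‖c‖)
    fun r => norm_tensorOperator_le r a b c

/-- The closed *-subalgebra generated by the elementary tensors. -/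
def tensorSubalgebra (A B C : Type u) [CStarAlgebra A] [CStarAlgebra B] [CStarAlgebra C] :
    StarSubalgebra ℂ (TensorAmbient A B C) :=
  (StarAlgebra.adjoin ℂ {x | ∃ (a : A) (b : B) (c : C), ambientTensor a b c = x}).topologicalClosure

/-- The minimal (spatial) tensor product `A ⊗ B ⊗ C` of unital C*-algebras: the completion of the
algebraic tensor product in the norm
`‖x‖ = sup ‖(ρ₁ ⊗ ρ₂ ⊗ ρ₃)(x)‖`, where `ρ₁`, `ρ₂`, `ρ₃` run over the representations of `A`, `B`,
`C` on Hilbert spaces. -/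
def Tensor (A B C : Type u) [CStarAlgebra A] [CStarAlgebra B] [CStarAlgebra C] : Type (u + 1) :=
  tensorSubalgebra A B C

instance instCStarAlgebraTensor : CStarAlgebra (Tensor A B C) :=
  StarSubalgebra.cstarAlgebra (tensorSubalgebra A B C)
    (h_closed := StarSubalgebra.isClosed_topologicalClosure _)

namespace Tensor

/-- The elementary tensor `a ⊗ b ⊗ c`. -/
def tmul (a : A) (b : B) (c : C) : Tensor A B C :=
  ⟨ambientTensor a b c, StarSubalgebra.le_topologicalClosure _
    (StarAlgebra.subset_adjoin ℂ _ ⟨a, b, c, rfl⟩)⟩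

/-- The pullback of representations does not change the operators on the tensor product of the
Hilbert spaces. -/
def operatorsComp (f : A →⋆ₐ[ℂ] A') (g : B →⋆ₐ[ℂ] B') (h : C →⋆ₐ[ℂ] C')
    (r : Representation A' × Representation B' × Representation C') :
    TensorOperators (r.1.comp f, r.2.1.comp g, r.2.2.comp h) →⋆ₐ[ℂ] TensorOperators r :=
  StarAlgHom.id ℂ (TensorOperators r)

theorem operatorsComp_tensorOperator (f : A →⋆ₐ[ℂ] A') (g : B →⋆ₐ[ℂ] B') (h : C →⋆ₐ[ℂ] C')
    (r : Representation A' × Representation B' × Representation C') (a : A) (b : B) (c : C) :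
    operatorsComp f g h r (tensorOperator (r.1.comp f, r.2.1.comp g, r.2.2.comp h) a b c) =
      tensorOperator r (f a) (g b) (h c) := by
  with_unfolding_all rfl

/-- The map of bounded families induced by the pullback of representations. -/
def ambientMap (f : A →⋆ₐ[ℂ] A') (g : B →⋆ₐ[ℂ] B') (h : C →⋆ₐ[ℂ] C') :
    TensorAmbient A B C →⋆ₐ[ℂ] TensorAmbient A' B' C' :=
  BoundedProduct.reindex
    (fun r : Representation A' × Representation B' × Representation C' =>
      (r.1.comp f, r.2.1.comp g, r.2.2.comp h)) (operatorsComp f g h)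

theorem ambientMap_ambientTensor (f : A →⋆ₐ[ℂ] A') (g : B →⋆ₐ[ℂ] B') (h : C →⋆ₐ[ℂ] C') (a : A)
    (b : B) (c : C) :
    ambientMap f g h (ambientTensor a b c) = ambientTensor (f a) (g b) (h c) := by
  refine BoundedProduct.ext fun r => ?_
  rw [ambientMap, BoundedProduct.eval_reindex, ambientTensor, ambientTensor,
    BoundedProduct.eval_mk, BoundedProduct.eval_mk]
  exact operatorsComp_tensorOperator f g h r a b c

theorem ambientMap_mem (f : A →⋆ₐ[ℂ] A') (g : B →⋆ₐ[ℂ] B') (h : C →⋆ₐ[ℂ] C')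
    (x : TensorAmbient A B C) (hx : x ∈ tensorSubalgebra A B C) :
    ambientMap f g h x ∈ tensorSubalgebra A' B' C' := by
  have hle : tensorSubalgebra A B C ≤ (tensorSubalgebra A' B' C').comap (ambientMap f g h) := by
    refine StarSubalgebra.topologicalClosure_minimal (StarAlgebra.adjoin_le ?_) ?_
    · rintro _ ⟨a, b, c, rfl⟩
      change ambientMap f g h (ambientTensor a b c) ∈ tensorSubalgebra A' B' C'
      rw [ambientMap_ambientTensor]
      exact (tmul (f a) (g b) (h c)).2
    · exact (StarSubalgebra.isClosed_topologicalClosure _).preimage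
        (continuous_starAlgHom (ambientMap f g h))
  exact hle hx

/-- The *-homomorphism `f ⊗ g ⊗ h : A ⊗ B ⊗ C → A' ⊗ B' ⊗ C'`. -/
def map (f : A →⋆ₐ[ℂ] A') (g : B →⋆ₐ[ℂ] B') (h : C →⋆ₐ[ℂ] C') :
    Tensor A B C →⋆ₐ[ℂ] Tensor A' B' C' :=
  StarAlgHom.codRestrict ((ambientMap f g h).comp (tensorSubalgebra A B C).subtype)
    (tensorSubalgebra A' B' C') fun x => ambientMap_mem f g h x.1 x.2

theorem map_tmul (f : A →⋆ₐ[ℂ] A') (g : B →⋆ₐ[ℂ] B') (h : C →⋆ₐ[ℂ] C') (a : A) (b : B) (c : C) :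
    map f g h (tmul a b c) = tmul (f a) (g b) (h c) :=
  Subtype.ext (ambientMap_ambientTensor f g h a b c)

theorem map_surjective (f : A →⋆ₐ[ℂ] A') (g : B →⋆ₐ[ℂ] B') (h : C →⋆ₐ[ℂ] C')
    (hf : Function.Surjective f) (hg : Function.Surjective g) (hh : Function.Surjective h) :
    Function.Surjective (map f g h) := by
  let S : StarSubalgebra ℂ (TensorAmbient A' B' C') :=
    ((tensorSubalgebra A' B' C').subtype.comp (map f g h)).range
  have hS : IsClosed (S : Set (TensorAmbient A' B' C')) := isClosed_range_starAlgHom _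
  have hle : tensorSubalgebra A' B' C' ≤ S := by
    refine StarSubalgebra.topologicalClosure_minimal (StarAlgebra.adjoin_le ?_) hS
    rintro _ ⟨a, b, c, rfl⟩
    obtain ⟨a, rfl⟩ := hf a
    obtain ⟨b, rfl⟩ := hg b
    obtain ⟨c, rfl⟩ := hh c
    exact ⟨tmul a b c, ambientMap_ambientTensor f g h a b c⟩
  intro y
  obtain ⟨x, hx⟩ := hle y.2
  exact ⟨x, Subtype.ext hx⟩

end Tensor

end Tensor

/-! ## The family defining the Heegaard odd quantum sphere `S⁵_H` -/

section Sphere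

/-- The tensor factors: `C(S¹)` for `true` and `𝒯` for `false`. -/
def Factor : Bool → Type 1
  | true => CircleAlgebra
  | false => Toeplitz

instance instCStarAlgebraFactor : ∀ b, CStarAlgebra (Factor b)
  | true => inferInstanceAs (CStarAlgebra CircleAlgebra)
  | false => inferInstanceAs (CStarAlgebra Toeplitz)

/-- The symbol map `𝒯 → C(S¹)`, or the identity map of `𝒯` or of `C(S¹)`. -/
def factorMap : ∀ b c : Bool, (b = true → c = true) → (Factor b →⋆ₐ[ℂ] Factor c)
  | true, true, _ => StarAlgHom.id ℂ CircleAlgebra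
  | false, false, _ => StarAlgHom.id ℂ Toeplitz
  | false, true, _ => symbol
  | true, false, h => absurd (h rfl) Bool.false_ne_true

theorem factorMap_surjective :
    ∀ (b c : Bool) (h : b = true → c = true), Function.Surjective (factorMap b c h)
  | true, true, _ => Function.surjective_id
  | false, false, _ => Function.surjective_id
  | false, true, _ => symbol_surjective
  | true, false, h => absurd (h rfl) Bool.false_ne_true

/-- The tensor product of three factors `C(S¹)` or `𝒯`, with `C(S¹)` exactly at the positions
`l` (numbered from `0`) for which `p l` is `true`. -/
abbrev FactorTensor (p : Fin 3 → Bool) : Type 2 :=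
  Tensor (Factor (p 0)) (Factor (p 1)) (Factor (p 2))

/-- The symbol map on the factors where `p` and `q` differ, tensored with the identity on the other
factors. -/
def factorTensorMap (p q : Fin 3 → Bool) (h : ∀ l, p l = true → q l = true) :
    FactorTensor p →⋆ₐ[ℂ] FactorTensor q :=
  Tensor.map (factorMap _ _ (h 0)) (factorMap _ _ (h 1)) (factorMap _ _ (h 2))

theorem factorTensorMap_surjective (p q : Fin 3 → Bool) (h : ∀ l, p l = true → q l = true) :
    Function.Surjective (factorTensorMap p q h) :=
  Tensor.map_surjective _ _ _ (factorMap_surjective _ _ _) (factorMap_surjective _ _ _)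
    (factorMap_surjective _ _ _)

/-- The family of surjections whose multi-pullback is the C*-algebra `C(S⁵_H)`. Here `A_i` is the
triple tensor product with `C(S¹)` at position `i` and `𝒯` at the other two positions, `A_{ij}` is
the one with `C(S¹)` at the positions `i` and `j` and `𝒯` at the third one, and `π^i_j` is the
symbol map on the factor `j` and the identity on the other factors. -/
def sphereFamily : SurjectiveFamily (Fin 3) where
  source i := FactorTensor fun l => decide (l = i)
  target e := FactorTensor fun l => decide (l ∈ e)
  proj e i _ hi := factorTensorMap _ _ fun l hl => by
    rw [decide_eq_true_eq] at hl ⊢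
    exact hl ▸ hi
  surjective _ _ _ _ := factorTensorMap_surjective _ _ _

end Sphere

end HeegaardSphere

end

noncomputable section

namespace HeegaardSphere

universe u v w

/-! Let `D` be the triple tensor product of `C(S¹)`. Applying the symbol to the remaining Toeplitz
factors maps every `A_i` and every `A_{ij}` to `D`, compatibly with all `π^i_j`. The heart of the
matter is that `π^i_j(ker π^i_k)` is exactly the kernel of `A_{ij} → D`. This kernel does not depend
on the order of `i` and `j`, which is condition 1. Moreover `φ^{ij}_k` then sends `[b]` to `[a]` as
soon as `a` and `b` have the same image in `D`, so condition 2 is transitivity of equality in `D`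
(`cocycleCondition_of_lift`).

That the image lies in the kernel is compatibility. For the converse, `A_{ij}` has a single Toeplitz
factor, at position `k`, and the map to `D` is `σ` there and the identity elsewhere. Its kernel is
the closed span of the elementary tensors whose factor at `k` lies in `ker σ`
(`mem_of_map_eq_zero`). This is an instance of exactness that holds because the other factors are
commutative: partitions of unity on the two circles reduce an approximation by elementary tensors to
finitely many elements of `𝒯` with small symbol, and these are corrected to have symbol zero.

Such an elementary tensor lifts to `A_i` with its factor at `k` unchanged, so `π^i_k` kills the
lift. Passing to the closure needs a closed image, which follows from the closed range of
*-homomorphisms (`isClosed_imageOfScalar`, `exists_lift_of_factorTensorMap_eq_zero`). -/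

/-! ### Norm estimates and partitions of unity -/

/-- Cauchy–Schwarz in the Hilbert module `D^n`, for the vectors `(p i)` and `(p i * k i)`. The bound
does not grow with the number of summands, so a partition may be refined without loss. -/
theorem norm_sum_conjugate_le {D ι : Type*} [CStarAlgebra D] [Fintype ι] (p k : ι → D)
    (hp : ∀ i, IsSelfAdjoint (p i)) (h1 : ∑ i, p i * p i = 1) (c : ℝ) (hc : 0 ≤ c)
    (hk : ∀ i, ‖k i‖ ≤ c) : ‖∑ i, p i * k i * p i‖ ≤ c := by
  let _ := CStarAlgebra.spectralOrder D
  have := CStarAlgebra.spectralOrderedRing D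
  rcases subsingleton_or_nontrivial D with hD | hD
  · rw [Subsingleton.elim (∑ i, p i * k i * p i) 0, norm_zero]
    exact hc
  let x : WithCStarModule D (ι → D) := (WithCStarModule.equiv D (ι → D)).symm p
  let y : WithCStarModule D (ι → D) := (WithCStarModule.equiv D (ι → D)).symm fun i => p i * k i
  have hxy : inner D x y = ∑ i, p i * k i * p i := by
    rw [WithCStarModule.pi_inner]
    refine Finset.sum_congr rfl fun i _ => ?_
    rw [WithCStarModule.inner_def]
    change p i * k i * star (p i) = _
    rw [(hp i).star_eq]
  have hx : ‖x‖ ^ 2 ≤ 1 := by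
    rw [WithCStarModule.pi_norm_sq]
    have : ∑ i, inner D (x i) (x i) = 1 := by
      rw [← h1]
      refine Finset.sum_congr rfl fun i _ => ?_
      rw [WithCStarModule.inner_def]
      change p i * star (p i) = _
      rw [(hp i).star_eq]
    rw [this, norm_one]
  have hy : ‖y‖ ^ 2 ≤ c ^ 2 := by
    rw [WithCStarModule.pi_norm_sq]
    have h2 : ∑ i, inner D (y i) (y i) = ∑ i, p i * (k i * star (k i)) * p i := by
      refine Finset.sum_congr rfl fun i _ => ?_
      rw [WithCStarModule.inner_def]
      change p i * k i * star (p i * k i) = _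
      rw [star_mul, (hp i).star_eq]
      simp only [mul_assoc]
    -- From `k i * star (k i) ≤ c²`, conjugated by `p i`; summing and using `∑ p i * p i = 1` bounds
    -- `‖y‖²` by `c²`.
    have hle : ∀ i, p i * (k i * star (k i)) * p i ≤ c ^ 2 • (p i * p i) := by
      intro i
      have h3 : k i * star (k i) ≤ algebraMap ℝ D (c ^ 2) := by
        refine (CStarAlgebra.norm_le_iff_le_algebraMap _ (by positivity)
          (mul_star_self_nonneg _)).1 ?_
        rw [CStarRing.norm_self_mul_star, sq]
        gcongr <;> exact hk i
      have h4 := (hp i).conjugate_le_conjugate h3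
      refine h4.trans_eq ?_
      rw [Algebra.algebraMap_eq_smul_one]
      simp
    rw [h2]
    have hnn : 0 ≤ ∑ i, p i * (k i * star (k i)) * p i :=
      Finset.sum_nonneg fun i _ => (hp i).conjugate_nonneg (mul_star_self_nonneg _)
    refine (CStarAlgebra.norm_le_iff_le_algebraMap _ (by positivity) hnn).2 ?_
    refine (Finset.sum_le_sum fun i _ => hle i).trans_eq ?_
    rw [← Finset.smul_sum, h1, Algebra.algebraMap_eq_smul_one]
  rw [← hxy]
  have hx' : ‖x‖ ≤ 1 := by
    nlinarith [norm_nonneg x]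
  have hy' : ‖y‖ ≤ c := abs_le_of_sq_le_sq' hy hc |>.2
  calc ‖inner D x y‖ ≤ ‖x‖ * ‖y‖ := CStarModule.norm_inner_le _
    _ ≤ 1 * c := by gcongr
    _ = c := one_mul c

/-- A partition of unity subordinate to a finite cover by sets on which every `f ∈ F` varies by less
than `ε`. Square roots of its members are taken so that they can flank an element on both sides, as
`norm_sum_conjugate_le` requires. -/
theorem exists_squared_partition {X : Type*} [TopologicalSpace X] [CompactSpace X] [T2Space X]
    (F : Finset C(X, ℂ)) (ε : ℝ) (hε : 0 < ε) :
    ∃ (n : ℕ) (x : Fin n → X) (φ : Fin n → C(X, ℂ)), (∀ m, IsSelfAdjoint (φ m)) ∧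
      ∑ m, φ m * φ m = 1 ∧ ∀ f ∈ F, ‖f - ∑ m, f (x m) • (φ m * φ m)‖ ≤ ε := by
  let U : X → Set X := fun z => ⋂ f ∈ F, {x | ‖f x - f z‖ < ε}
  have hUo : ∀ z, IsOpen (U z) := fun z =>
    isOpen_biInter_finset fun f _ => isOpen_lt (by fun_prop) continuous_const
  have hUz : ∀ z, z ∈ U z := fun z => by simp [U, hε]
  obtain ⟨t, ht⟩ := isCompact_univ.elim_finite_subcover U hUo
    (fun z _ => Set.mem_iUnion.2 ⟨z, hUz z⟩)
  obtain ⟨ρ, hρ⟩ := PartitionOfUnity.exists_isSubordinate isClosed_univ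
    (fun m : Fin t.card => U (t.equivFin.symm m)) (fun m => hUo _) (by
      intro z hz
      obtain ⟨y, hy, hzy⟩ := Set.mem_iUnion₂.1 (ht hz)
      refine Set.mem_iUnion.2 ⟨t.equivFin ⟨y, hy⟩, ?_⟩
      simpa using hzy)
  let φ : Fin t.card → C(X, ℂ) := fun m => ⟨fun z => (Real.sqrt (ρ m z) : ℂ), by fun_prop⟩
  have hφ : ∀ m z, φ m z * φ m z = (ρ m z : ℂ) := fun m z => by
    change (Real.sqrt (ρ m z) : ℂ) * (Real.sqrt (ρ m z) : ℂ) = _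
    rw [← Complex.ofReal_mul, Real.mul_self_sqrt (ρ.nonneg m z)]
  have hsum : ∀ z, ∑ m, ρ m z = 1 := fun z => by
    rw [← finsum_eq_sum_of_fintype]
    exact ρ.sum_eq_one (Set.mem_univ z)
  refine ⟨t.card, fun m => t.equivFin.symm m, φ, fun m => ?_, ?_, fun f hf => ?_⟩
  · ext z
    exact Complex.conj_ofReal _
  · ext z
    simp only [ContinuousMap.coe_sum, Finset.sum_apply, ContinuousMap.mul_apply, hφ,
      ContinuousMap.one_apply]
    rw [← Complex.ofReal_sum, hsum, Complex.ofReal_one]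
  · refine (ContinuousMap.norm_le _ hε.le).2 fun z => ?_
    -- As the weights add up to `1`, the error at `z` is an average of the differences `f z - f (x
    -- m)`; only those `m` with `z` in the `m`-th set of the cover carry weight.
    have e : (f - ∑ m, f (t.equivFin.symm m) • (φ m * φ m)) z =
        ∑ m, (ρ m z : ℂ) * (f z - f (t.equivFin.symm m)) := by
      simp only [ContinuousMap.sub_apply, ContinuousMap.coe_sum, Finset.sum_apply,
        ContinuousMap.smul_apply, ContinuousMap.mul_apply, hφ, mul_sub, Finset.sum_sub_distrib]
      rw [← Finset.sum_mul, ← Complex.ofReal_sum, hsum, Complex.ofReal_one, one_mul]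
      simp only [smul_eq_mul, mul_comm]
    rw [e]
    calc ‖∑ m, (ρ m z : ℂ) * (f z - f (t.equivFin.symm m))‖
        ≤ ∑ m, ρ m z * ε := by
          refine norm_sum_le_of_le _ fun m _ => ?_
          rw [norm_mul, Complex.norm_real, Real.norm_of_nonneg (ρ.nonneg m z)]
          by_cases h0 : ρ m z = 0
          · simp [h0]
          · have hz : z ∈ U (t.equivFin.symm m) := hρ m (subset_tsupport _ h0)
            have := Set.mem_iInter₂.1 hz f hf
            exact mul_le_mul_of_nonneg_left (le_of_lt this) (ρ.nonneg m z)
      _ = ε := by rw [← Finset.sum_mul, hsum, one_mul]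

/-! ### Multilinearity and adjoints of tensor product operators -/

namespace HilbertTensor

variable {H₁ H₂ H₃ : Type u} [NormedAddCommGroup H₁] [InnerProductSpace ℂ H₁]
  [NormedAddCommGroup H₂] [InnerProductSpace ℂ H₂] [NormedAddCommGroup H₃]
  [InnerProductSpace ℂ H₃]

/-- A closed property that is additive and holds for elementary tensors holds everywhere. -/
theorem induction_tmul {p : HilbertTensor H₁ H₂ H₃ → Prop} (hp : IsClosed {x | p x})
    (h : ∀ x y z, p (tmul x y z)) (h0 : p 0) (hadd : ∀ v w, p v → p w → p (v + w))
    (v : HilbertTensor H₁ H₂ H₃) : p v := by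
  refine UniformSpace.Completion.induction_on (p := p) v hp fun t => ?_
  induction t with
  | zero => exact h0
  | add t t' ht ht' =>
    have := hadd _ _ ht ht'
    change p ((t + t' : (H₁ ⊗[ℂ] H₂) ⊗[ℂ] H₃) : UniformSpace.Completion _)
    rw [UniformSpace.Completion.coe_add]
    exact this
  | tmul t z =>
    induction t with
    | zero =>
      rw [TensorProduct.zero_tmul]
      exact h0
    | add t t' ht ht' =>
      have := hadd _ _ ht ht'
      change p (((t + t') ⊗ₜ[ℂ] z : (H₁ ⊗[ℂ] H₂) ⊗[ℂ] H₃) : UniformSpace.Completion _)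
      rw [TensorProduct.add_tmul, UniformSpace.Completion.coe_add]
      exact this
    | tmul x y => exact h x y z

theorem continuousLinearMap_ext {S T : HilbertTensor H₁ H₂ H₃ →L[ℂ] HilbertTensor H₁ H₂ H₃}
    (h : ∀ x y z, S (tmul x y z) = T (tmul x y z)) : S = T := by
  refine ContinuousLinearMap.ext fun v => ?_
  induction v using induction_tmul with
  | hp => exact isClosed_eq S.continuous T.continuous
  | h x y z => exact h x y z
  | h0 => simp
  | hadd v w hv hw => rw [map_add, map_add, hv, hw]

theorem add_tmul (x x' : H₁) (y : H₂) (z : H₃) : tmul (x + x') y z = tmul x y z + tmul x' y z := by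
  refine Eq.trans ?_ (UniformSpace.Completion.coe_add _ _)
  rw [← TensorProduct.add_tmul, ← TensorProduct.add_tmul]
  rfl

theorem tmul_add_tmul (x : H₁) (y y' : H₂) (z : H₃) :
    tmul x (y + y') z = tmul x y z + tmul x y' z := by
  refine Eq.trans ?_ (UniformSpace.Completion.coe_add _ _)
  rw [← TensorProduct.add_tmul, ← TensorProduct.tmul_add]
  rfl

theorem tmul_add (x : H₁) (y : H₂) (z z' : H₃) :
    tmul x y (z + z') = tmul x y z + tmul x y z' := by
  refine Eq.trans ?_ (UniformSpace.Completion.coe_add _ _)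
  rw [← TensorProduct.tmul_add]
  rfl

theorem smul_tmul (c : ℂ) (x : H₁) (y : H₂) (z : H₃) : tmul (c • x) y z = c • tmul x y z := by
  refine Eq.trans ?_ (UniformSpace.Completion.coe_smul _ _)
  rw [TensorProduct.smul_tmul', TensorProduct.smul_tmul']
  rfl

theorem tmul_smul_tmul (c : ℂ) (x : H₁) (y : H₂) (z : H₃) :
    tmul x (c • y) z = c • tmul x y z := by
  refine Eq.trans ?_ (UniformSpace.Completion.coe_smul _ _)
  rw [TensorProduct.smul_tmul', ← TensorProduct.tmul_smul]
  rfl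

theorem tmul_smul (c : ℂ) (x : H₁) (y : H₂) (z : H₃) : tmul x y (c • z) = c • tmul x y z := by
  refine Eq.trans ?_ (UniformSpace.Completion.coe_smul _ _)
  rw [← TensorProduct.tmul_smul]
  rfl

theorem inner_tmul (x x' : H₁) (y y' : H₂) (z z' : H₃) :
    inner ℂ (tmul x y z) (tmul x' y' z') = inner ℂ x x' * inner ℂ y y' * inner ℂ z z' := by
  refine (UniformSpace.Completion.inner_coe _ _).trans ?_
  rw [TensorProduct.inner_tmul, TensorProduct.inner_tmul]

theorem map_one : map (1 : H₁ →L[ℂ] H₁) (1 : H₂ →L[ℂ] H₂) (1 : H₃ →L[ℂ] H₃) = 1 :=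
  continuousLinearMap_ext fun x y z => by rw [map_tmul]; rfl

theorem map_mul (R R' : H₁ →L[ℂ] H₁) (S S' : H₂ →L[ℂ] H₂) (T T' : H₃ →L[ℂ] H₃) :
    map (R * R') (S * S') (T * T') = map R S T * map R' S' T' :=
  continuousLinearMap_ext fun x y z => by
    rw [mul_apply_eq_comp, map_tmul, map_tmul, map_tmul]; rfl

theorem add_map (R R' : H₁ →L[ℂ] H₁) (S : H₂ →L[ℂ] H₂) (T : H₃ →L[ℂ] H₃) :
    map (R + R') S T = map R S T + map R' S T :=
  continuousLinearMap_ext fun x y z => by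
    rw [_root_.add_apply, map_tmul, map_tmul, map_tmul, ← add_tmul]; rfl

theorem map_add_map (R : H₁ →L[ℂ] H₁) (S S' : H₂ →L[ℂ] H₂) (T : H₃ →L[ℂ] H₃) :
    map R (S + S') T = map R S T + map R S' T :=
  continuousLinearMap_ext fun x y z => by
    rw [_root_.add_apply, map_tmul, map_tmul, map_tmul, ← tmul_add_tmul]; rfl

theorem map_add (R : H₁ →L[ℂ] H₁) (S : H₂ →L[ℂ] H₂) (T T' : H₃ →L[ℂ] H₃) :
    map R S (T + T') = map R S T + map R S T' :=
  continuousLinearMap_ext fun x y z => by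
    rw [_root_.add_apply, map_tmul, map_tmul, map_tmul, ← tmul_add]; rfl

theorem smul_map (c : ℂ) (R : H₁ →L[ℂ] H₁) (S : H₂ →L[ℂ] H₂) (T : H₃ →L[ℂ] H₃) :
    map (c • R) S T = c • map R S T :=
  continuousLinearMap_ext fun x y z => by
    rw [_root_.smul_apply, map_tmul, map_tmul, ← smul_tmul]; rfl

theorem map_smul_map (c : ℂ) (R : H₁ →L[ℂ] H₁) (S : H₂ →L[ℂ] H₂) (T : H₃ →L[ℂ] H₃) :
    map R (c • S) T = c • map R S T :=
  continuousLinearMap_ext fun x y z => by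
    rw [_root_.smul_apply, map_tmul, map_tmul, ← tmul_smul_tmul]; rfl

theorem map_smul (c : ℂ) (R : H₁ →L[ℂ] H₁) (S : H₂ →L[ℂ] H₂) (T : H₃ →L[ℂ] H₃) :
    map R S (c • T) = c • map R S T :=
  continuousLinearMap_ext fun x y z => by
    rw [_root_.smul_apply, map_tmul, map_tmul, ← tmul_smul]; rfl

theorem map_star [CompleteSpace H₁] [CompleteSpace H₂] [CompleteSpace H₃] (R : H₁ →L[ℂ] H₁)
    (S : H₂ →L[ℂ] H₂) (T : H₃ →L[ℂ] H₃) : map (star R) (star S) (star T) = star (map R S T) := by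
  refine (ContinuousLinearMap.eq_adjoint_iff _ _).2 ?_
  intro v w
  induction v using induction_tmul with
  | hp => exact isClosed_eq (by fun_prop) (by fun_prop)
  | h0 => simp
  | hadd v v' hv hv' => rw [_root_.map_add, inner_add_left, inner_add_left, hv, hv']
  | h x y z =>
    induction w using induction_tmul with
    | hp => exact isClosed_eq (by fun_prop) (by fun_prop)
    | h0 => simp
    | hadd w w' hw hw' => rw [_root_.map_add, inner_add_right, inner_add_right, hw, hw']
    | h x' y' z' =>
      simp only [map_tmul, inner_tmul, ContinuousLinearMap.star_eq_adjoint,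
        ContinuousLinearMap.adjoint_inner_left]

end HilbertTensor

/-! ### Algebra of elementary tensors in the spatial tensor product -/

namespace Tensor

variable {A B C : Type u} [CStarAlgebra A] [CStarAlgebra B] [CStarAlgebra C]

/-- The operators by which an element of `A ⊗ B ⊗ C` acts on `H₁ ⊗ H₂ ⊗ H₃`. -/
def evalHom (r : Representation A × Representation B × Representation C) :
    Tensor A B C →⋆ₐ[ℂ] TensorOperators r :=
  (BoundedProduct.eval r).comp (tensorSubalgebra A B C).subtype

theorem evalHom_tmul (r : Representation A × Representation B × Representation C) (a : A) (b : B)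
    (c : C) : evalHom r (tmul a b c) = tensorOperator r a b c := rfl

theorem ext_evalHom {x y : Tensor A B C} (h : ∀ r, evalHom r x = evalHom r y) : x = y :=
  Subtype.ext (BoundedProduct.ext h)

theorem one_tmul : (tmul 1 1 1 : Tensor A B C) = 1 := ext_evalHom fun r => by
  rw [evalHom_tmul, tensorOperator, map_one, map_one, map_one, map_one]
  exact HilbertTensor.map_one

theorem tmul_mul_tmul (a a' : A) (b b' : B) (c c' : C) :
    tmul (a * a') (b * b') (c * c') = tmul a b c * tmul a' b' c' := ext_evalHom fun r => by
  rw [map_mul, evalHom_tmul, evalHom_tmul, evalHom_tmul, tensorOperator, map_mul, map_mul, map_mul]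
  exact HilbertTensor.map_mul _ _ _ _ _ _

theorem star_tmul (a : A) (b : B) (c : C) :
    tmul (star a) (star b) (star c) = star (tmul a b c) := ext_evalHom fun r => by
  rw [map_star, evalHom_tmul, evalHom_tmul, tensorOperator, map_star, map_star, map_star]
  exact HilbertTensor.map_star _ _ _

theorem add_tmul (a a' : A) (b : B) (c : C) :
    tmul (a + a') b c = tmul a b c + tmul a' b c := ext_evalHom fun r => by
  rw [map_add, evalHom_tmul, evalHom_tmul, evalHom_tmul, tensorOperator, map_add]
  exact HilbertTensor.add_map _ _ _ _

theorem tmul_add_tmul (a : A) (b b' : B) (c : C) :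
    tmul a (b + b') c = tmul a b c + tmul a b' c := ext_evalHom fun r => by
  rw [map_add, evalHom_tmul, evalHom_tmul, evalHom_tmul, tensorOperator, map_add]
  exact HilbertTensor.map_add_map _ _ _ _

theorem tmul_add (a : A) (b : B) (c c' : C) :
    tmul a b (c + c') = tmul a b c + tmul a b c' := ext_evalHom fun r => by
  rw [map_add, evalHom_tmul, evalHom_tmul, evalHom_tmul, tensorOperator, map_add]
  exact HilbertTensor.map_add _ _ _ _

theorem smul_tmul (t : ℂ) (a : A) (b : B) (c : C) :
    tmul (t • a) b c = t • tmul a b c := ext_evalHom fun r => by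
  rw [map_smul, evalHom_tmul, evalHom_tmul, tensorOperator, map_smul]
  exact HilbertTensor.smul_map _ _ _ _

theorem tmul_smul_tmul (t : ℂ) (a : A) (b : B) (c : C) :
    tmul a (t • b) c = t • tmul a b c := ext_evalHom fun r => by
  rw [map_smul, evalHom_tmul, evalHom_tmul, tensorOperator, map_smul]
  exact HilbertTensor.map_smul_map _ _ _ _

theorem tmul_smul (t : ℂ) (a : A) (b : B) (c : C) :
    tmul a b (t • c) = t • tmul a b c := ext_evalHom fun r => by
  rw [map_smul, evalHom_tmul, evalHom_tmul, tensorOperator, map_smul]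
  exact HilbertTensor.map_smul _ _ _ _

variable (A B C)

/-- The embedding `a ↦ a ⊗ 1 ⊗ 1`. -/
def inclLeft : A →⋆ₐ[ℂ] Tensor A B C where
  toFun a := tmul a 1 1
  map_one' := one_tmul
  map_mul' a a' := by simpa using tmul_mul_tmul a a' (1 : B) 1 (1 : C) 1
  map_zero' := by simpa using smul_tmul 0 (0 : A) (1 : B) (1 : C)
  map_add' a a' := add_tmul _ _ _ _
  commutes' t := by
    rw [Algebra.algebraMap_eq_smul_one, Algebra.algebraMap_eq_smul_one, smul_tmul, one_tmul]
  map_star' a := by simpa using star_tmul a (1 : B) (1 : C)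

/-- The embedding `b ↦ 1 ⊗ b ⊗ 1`. -/
def inclMiddle : B →⋆ₐ[ℂ] Tensor A B C where
  toFun b := tmul 1 b 1
  map_one' := one_tmul
  map_mul' b b' := by simpa using tmul_mul_tmul (1 : A) 1 b b' (1 : C) 1
  map_zero' := by simpa using tmul_smul_tmul 0 (1 : A) (0 : B) (1 : C)
  map_add' b b' := tmul_add_tmul _ _ _ _
  commutes' t := by
    rw [Algebra.algebraMap_eq_smul_one, Algebra.algebraMap_eq_smul_one, tmul_smul_tmul, one_tmul]
  map_star' b := by simpa using star_tmul (1 : A) b (1 : C)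

/-- The embedding `c ↦ 1 ⊗ 1 ⊗ c`. -/
def inclRight : C →⋆ₐ[ℂ] Tensor A B C where
  toFun c := tmul 1 1 c
  map_one' := one_tmul
  map_mul' c c' := by simpa using tmul_mul_tmul (1 : A) 1 (1 : B) 1 c c'
  map_zero' := by simpa using tmul_smul 0 (1 : A) (1 : B) (0 : C)
  map_add' c c' := tmul_add _ _ _ _
  commutes' t := by
    rw [Algebra.algebraMap_eq_smul_one, Algebra.algebraMap_eq_smul_one, tmul_smul, one_tmul]
  map_star' c := by simpa using star_tmul (1 : A) (1 : B) c

/-- Products and adjoints of elementary tensors are elementary, so their linear span is already a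
*-subalgebra and contains the one they generate. -/
theorem dense_span_tmul :
    Dense (Submodule.span ℂ {x : Tensor A B C | ∃ a b c, tmul a b c = x} : Set (Tensor A B C)) := by
  have hmul : ∀ x ∈ Submodule.span ℂ {x | ∃ (a : A) (b : B) (c : C), ambientTensor a b c = x},
      ∀ y ∈ Submodule.span ℂ {x | ∃ (a : A) (b : B) (c : C), ambientTensor a b c = x},
      x * y ∈ Submodule.span ℂ {x | ∃ (a : A) (b : B) (c : C), ambientTensor a b c = x} := by
    intro x hx y hy
    induction hx, hy using Submodule.span_induction₂ with
    | mem_mem x y hx hy =>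
      obtain ⟨a, b, c, rfl⟩ := hx
      obtain ⟨a', b', c', rfl⟩ := hy
      exact Submodule.subset_span ⟨a * a', b * b', c * c',
        congrArg Subtype.val (tmul_mul_tmul a a' b b' c c')⟩
    | zero_left => simp
    | zero_right => simp
    | add_left x y z _ _ _ h h' => rw [add_mul]; exact add_mem h h'
    | add_right x y z _ _ _ h h' => rw [mul_add]; exact add_mem h h'
    | smul_left t x y _ _ h => rw [smul_mul_assoc]; exact Submodule.smul_mem _ _ h
    | smul_right t x y _ _ h => rw [mul_smul_comm]; exact Submodule.smul_mem _ _ h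
  let S : StarSubalgebra ℂ (TensorAmbient A B C) :=
    { carrier := Submodule.span ℂ {x | ∃ (a : A) (b : B) (c : C), ambientTensor a b c = x}
      mul_mem' := fun hx hy => hmul _ hx _ hy
      add_mem' := fun hx hy => add_mem hx hy
      algebraMap_mem' := fun t => by
        rw [Algebra.algebraMap_eq_smul_one]
        exact Submodule.smul_mem _ _ (Submodule.subset_span
          ⟨1, 1, 1, congrArg Subtype.val (one_tmul (A := A) (B := B) (C := C))⟩)
      star_mem' := fun {x} hx => by
        change x ∈ Submodule.span ℂ _ at hx
        change star x ∈ Submodule.span ℂ _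
        induction hx using Submodule.span_induction with
        | mem x hx =>
          obtain ⟨a, b, c, rfl⟩ := hx
          exact Submodule.subset_span ⟨star a, star b, star c,
            congrArg Subtype.val (star_tmul a b c)⟩
        | zero => simp
        | add x y _ _ h h' => rw [star_add]; exact add_mem h h'
        | smul t x _ h => rw [star_smul]; exact Submodule.smul_mem _ _ h }
  have hle : StarAlgebra.adjoin ℂ {x | ∃ (a : A) (b : B) (c : C), ambientTensor a b c = x} ≤ S :=
    StarAlgebra.adjoin_le Submodule.subset_span
  -- The span was computed in the ambient product, whereas density is claimed in the subtype; the
  -- inclusion carries one span onto the other.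
  let val : Tensor A B C →ₗ[ℂ] TensorAmbient A B C :=
    (tensorSubalgebra A B C).subtype.toAlgHom.toLinearMap
  have himage : Submodule.span ℂ {x | ∃ (a : A) (b : B) (c : C), ambientTensor a b c = x} =
      (Submodule.span ℂ {x : Tensor A B C | ∃ a b c, tmul a b c = x}).map val := by
    rw [Submodule.map_span]
    congr 1
    ext x
    constructor
    · rintro ⟨a, b, c, rfl⟩
      exact ⟨tmul a b c, ⟨a, b, c, rfl⟩, rfl⟩
    · rintro ⟨_, ⟨a, b, c, rfl⟩, rfl⟩
      exact ⟨a, b, c, rfl⟩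
  intro x
  refine closure_subtype.2 ?_
  refine closure_mono ?_ x.2
  intro y hy
  have hy' : y ∈ Submodule.span ℂ _ := hle hy
  rw [himage] at hy'
  exact hy'

end Tensor

/-! ### The kernel of a symbol map tensored with commutative algebras -/

theorem conjugate_mul_of_commute {R : Type*} [Monoid R] {a b c : R} (hab : Commute a b)
    (hac : Commute a c) (hbc : Commute b c) : a * b * c * (a * b) = a * a * (b * b) * c :=
  calc a * b * c * (a * b) = a * (b * (c * a)) * b := by simp only [mul_assoc]
    _ = a * ((b * a) * c) * b := by rw [← hac.eq, mul_assoc b a c]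
    _ = a * a * b * (c * b) := by rw [← hab.eq]; simp only [mul_assoc]
    _ = a * a * (b * b) * c := by rw [← hbc.eq]; simp only [mul_assoc]

/-- The open mapping theorem. -/
theorem exists_bounded_lift {T S : Type*} [CStarAlgebra T] [CStarAlgebra S] (σ : T →⋆ₐ[ℂ] S)
    (hσ : Function.Surjective σ) :
    ∃ C : ℝ, 0 < C ∧ ∀ h, ∃ t, σ t = h ∧ ‖t‖ ≤ C * ‖h‖ := by
  let L : T →L[ℂ] S := ⟨σ.toAlgHom.toLinearMap, continuous_starAlgHom σ⟩
  exact L.exists_preimage_norm_le hσ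

/-- Let `D` be generated by commuting images of `C(X)`, `C(Y)` and `T`, and let `P` be a map which
on the image of `T` dominates `σ : T → C(Z)` pointwise. Then the kernel of `P` is the closed linear
span of the products whose last factor comes from `ker σ`. -/
theorem mem_of_map_eq_zero {X Y Z T D D' : Type*} [TopologicalSpace X] [CompactSpace X]
    [T2Space X] [TopologicalSpace Y] [CompactSpace Y] [T2Space Y] [TopologicalSpace Z]
    [CompactSpace Z] [CStarAlgebra T] [CStarAlgebra D] [CStarAlgebra D']
    (σ : T →⋆ₐ[ℂ] C(Z, ℂ)) (hσ : Function.Surjective σ) (β : C(X, ℂ) →⋆ₐ[ℂ] D)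
    (γ : C(Y, ℂ) →⋆ₐ[ℂ] D) (α : T →⋆ₐ[ℂ] D) (hβγ : ∀ f g, Commute (β f) (γ g))
    (hβα : ∀ f c, Commute (β f) (α c)) (hγα : ∀ g c, Commute (γ g) (α c))
    (hdense : Dense (Submodule.span ℂ {d | ∃ f g c, β f * γ g * α c = d} : Set D))
    (P : D →⋆ₐ[ℂ] D')
    (hP : ∀ (n : ℕ) (f : Fin n → C(X, ℂ)) (g : Fin n → C(Y, ℂ)) (c : Fin n → T) (x : X) (y : Y)
      (z : Z), ‖∑ l, f l x * g l y * σ (c l) z‖ ≤ ‖P (∑ l, β (f l) * γ (g l) * α (c l))‖)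
    (M : Submodule ℂ D) (hM : IsClosed (M : Set D))
    (hmem : ∀ f g c, σ c = 0 → β f * γ g * α c ∈ M) (d : D) (hd : P d = 0) : d ∈ M := by
  obtain ⟨C, hC, hlift⟩ := exists_bounded_lift σ hσ
  change d ∈ (M : Set D)
  rw [← hM.closure_eq, Metric.mem_closure_iff]
  intro ε hε
  -- Error budget: `δ` from `d` to a finite sum of products, `δ` from that sum to its
  -- discretisation, `C * δ` for the correction into `M`, and one `δ` of slack.
  set δ : ℝ := ε / (C + 3) with hδdef
  have hδ : 0 < δ := by positivity
  obtain ⟨y, hy, hdy⟩ := Metric.mem_closure_iff.1 (hdense d) δ hδ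
  obtain ⟨n, f, g, c, rfl⟩ : ∃ (n : ℕ) (f : Fin n → C(X, ℂ)) (g : Fin n → C(Y, ℂ))
      (c : Fin n → T), ∑ l, β (f l) * γ (g l) * α (c l) = y := by
    obtain ⟨n, t, e, rfl⟩ := (Submodule.mem_span_set' (R := ℂ)).1 hy
    choose f g c hfgc using fun l => (e l).2
    -- The coefficients of the linear combination are absorbed into the first factors.
    refine ⟨n, fun l => t l • f l, g, c, Finset.sum_congr rfl fun l _ => ?_⟩
    rw [map_smul, smul_mul_assoc, smul_mul_assoc, hfgc]
  classical
  choose a x φ hφ hφ1 hφf using fun N : ℕ => exists_squared_partition (Finset.univ.image f)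
    (1 / ((N : ℝ) + 1)) (by positivity)
  choose b y ψ hψ hψ1 hψg using fun N : ℕ => exists_squared_partition (Finset.univ.image g)
    (1 / ((N : ℝ) + 1)) (by positivity)
  have hf : ∀ l, Filter.Tendsto (fun N => ∑ m, f l (x N m) • (φ N m * φ N m)) Filter.atTop
      (nhds (f l)) := fun l => by
    refine tendsto_iff_norm_sub_tendsto_zero.2 (squeeze_zero (fun _ => norm_nonneg _)
      (fun N => ?_) tendsto_one_div_add_atTop_nhds_zero_nat)
    rw [norm_sub_rev]
    exact hφf N _ (Finset.mem_image_of_mem _ (Finset.mem_univ l))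
  have hg : ∀ l, Filter.Tendsto (fun N => ∑ m, g l (y N m) • (ψ N m * ψ N m)) Filter.atTop
      (nhds (g l)) := fun l => by
    refine tendsto_iff_norm_sub_tendsto_zero.2 (squeeze_zero (fun _ => norm_nonneg _)
      (fun N => ?_) tendsto_one_div_add_atTop_nhds_zero_nat)
    rw [norm_sub_rev]
    exact hψg N _ (Finset.mem_image_of_mem _ (Finset.mem_univ l))
  -- A sequence of ever finer partitions is used so that continuity of the operations replaces an
  -- explicit estimate of the discretisation error.
  have hlim : Filter.Tendsto (fun N => ∑ l, β (∑ m, f l (x N m) • (φ N m * φ N m)) *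
      γ (∑ m, g l (y N m) • (ψ N m * ψ N m)) * α (c l)) Filter.atTop
      (nhds (∑ l, β (f l) * γ (g l) * α (c l))) :=
    tendsto_finsetSum _ fun l _ =>
      ((((continuous_starAlgHom β).tendsto _).comp (hf l)).mul
        (((continuous_starAlgHom γ).tendsto _).comp (hg l))).mul_const _
  obtain ⟨N, hN⟩ := (Metric.tendsto_nhds.1 hlim δ hδ).exists
  let p : Fin (a N) × Fin (b N) → D := fun i => β (φ N i.1) * γ (ψ N i.2)
  -- The slice of the finite sum at the sample point `(x N i.1, y N i.2)`. By commutation the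
  -- discretised sum is `∑ p i * α (t i) * p i`.
  let t : Fin (a N) × Fin (b N) → T := fun i => ∑ l, (f l (x N i.1) * g l (y N i.2)) • c l
  have hp : ∀ i, IsSelfAdjoint (p i) := fun i => by
    change star (β (φ N i.1) * γ (ψ N i.2)) = _
    rw [star_mul, ← map_star, ← map_star, (hφ N _).star_eq, (hψ N _).star_eq]
    exact (hβγ _ _).eq.symm
  have hpp : ∀ i s, p i * α s * p i =
      β (φ N i.1 * φ N i.1) * γ (ψ N i.2 * ψ N i.2) * α s := fun i s => by
    rw [map_mul, map_mul]
    exact conjugate_mul_of_commute (hβγ _ _) (hβα _ _) (hγα _ _)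
  have hp1 : ∑ i, p i * p i = 1 := by
    have h1 : ∀ i, p i * p i = β (φ N i.1 * φ N i.1) * γ (ψ N i.2 * ψ N i.2) := fun i => by
      simpa using hpp i 1
    simp_rw [h1]
    rw [Fintype.sum_prod_type]
    dsimp only
    rw [← Finset.sum_mul_sum, ← map_sum, ← map_sum, hφ1, hψ1, map_one,
      map_one, one_mul]
  have hsum : ∑ l, β (∑ m, f l (x N m) • (φ N m * φ N m)) *
      γ (∑ m, g l (y N m) • (ψ N m * ψ N m)) * α (c l) = ∑ i, p i * α (t i) * p i := by
    simp_rw [hpp, t, map_sum, map_smul, Finset.sum_mul_sum, Finset.sum_mul, Finset.mul_sum]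
    symm
    rw [Finset.sum_comm]
    refine Finset.sum_congr rfl fun l _ => ?_
    rw [Fintype.sum_prod_type]
    refine Finset.sum_congr rfl fun m _ => Finset.sum_congr rfl fun m' _ => ?_
    simp only [smul_mul_assoc, mul_smul_comm, smul_smul]
    rw [mul_comm]
  have hPy : ‖P (∑ l, β (f l) * γ (g l) * α (c l))‖ ≤ δ := by
    have h1 : P (∑ l, β (f l) * γ (g l) * α (c l)) =
        P (∑ l, β (f l) * γ (g l) * α (c l) - d) := by rw [map_sub P, hd, sub_zero]
    rw [h1]
    refine (norm_starAlgHom_le P _).trans ?_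
    rw [← dist_eq_norm, dist_comm]
    exact hdy.le
  -- The values of `σ (t i)` are values of the finite sum at points of `X × Y × Z`, hence by `hP` at
  -- most the norm of its image under `P`. That image is small because `P d = 0`.
  have ht : ∀ i, ‖σ (t i)‖ ≤ δ := fun i => by
    refine (ContinuousMap.norm_le _ hδ.le).2 fun z => ?_
    refine le_trans (le_of_eq ?_) ((hP n f g c (x N i.1) (y N i.2) z).trans hPy)
    simp [t, map_sum]
  -- Subtracting the small lift `k i` of `σ (t i)` puts `t i - k i` in `ker σ`, so the corrected sum
  -- lies in `M`; `norm_sum_conjugate_le` bounds the total correction by `C * δ`.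
  choose k hk hk' using fun i => hlift (σ (t i))
  refine ⟨∑ i, p i * α (t i - k i) * p i, ?_, ?_⟩
  · refine Submodule.sum_mem _ fun i _ => ?_
    rw [hpp]
    exact hmem _ _ _ (by rw [map_sub, hk, sub_self])
  · have h1 : ‖∑ i, p i * α (k i) * p i‖ ≤ C * δ :=
      norm_sum_conjugate_le p _ hp hp1 _ (by positivity) fun i =>
        (norm_starAlgHom_le α _).trans ((hk' i).trans (by gcongr; exact ht i))
    have h2 : ∑ i, p i * α (t i) * p i - ∑ i, p i * α (t i - k i) * p i =
        ∑ i, p i * α (k i) * p i := by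
      rw [← Finset.sum_sub_distrib]
      refine Finset.sum_congr rfl fun i _ => ?_
      rw [map_sub, mul_sub, sub_mul, sub_sub_cancel]
    rw [hsum] at hN
    rw [← h2, ← dist_eq_norm] at h1
    calc dist d (∑ i, p i * α (t i - k i) * p i)
        ≤ dist d (∑ l, β (f l) * γ (g l) * α (c l)) +
          dist (∑ l, β (f l) * γ (g l) * α (c l)) (∑ i, p i * α (t i) * p i) +
          dist (∑ i, p i * α (t i) * p i) (∑ i, p i * α (t i - k i) * p i) :=
          dist_triangle4 _ _ _ _
      _ < δ + δ + (C * δ + δ) := by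
          rw [dist_comm] at hN
          linarith
      _ = ε := by rw [hδdef]; field_simp; ring

/-! ### Point evaluations and the kernel for each position of the Toeplitz factor -/

/-- The one-dimensional representation of `C(X)` given by the evaluation at a point. -/
def pointRepresentation {X : Type u} [TopologicalSpace X] [CompactSpace X] (x : X) :
    Representation C(X, ℂ) where
  space := EuclideanSpace ℂ PUnit.{u + 1}
  toHom := (StarAlgHom.ofId ℂ _).comp (ContinuousMap.evalStarAlgHom ℂ ℂ x)

theorem pointRepresentation_apply {X : Type u} [TopologicalSpace X] [CompactSpace X] (x : X)
    (f : C(X, ℂ)) : (pointRepresentation x).toHom f = f x • 1 :=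
  Algebra.algebraMap_eq_smul_one (R := ℂ)
    (A := EuclideanSpace ℂ PUnit.{u + 1} →L[ℂ] EuclideanSpace ℂ PUnit.{u + 1}) (f x)

/-- Three points give a triple of one-dimensional representations, on which an elementary tensor
acts as the scalar `f x * g y * h z`. This is the lower bound `hP` of `mem_of_map_eq_zero`. -/
theorem Tensor.norm_sum_apply_le {X Y Z : Type u} [TopologicalSpace X] [CompactSpace X]
    [TopologicalSpace Y] [CompactSpace Y] [TopologicalSpace Z] [CompactSpace Z] (n : ℕ)
    (f : Fin n → C(X, ℂ)) (g : Fin n → C(Y, ℂ)) (h : Fin n → C(Z, ℂ)) (x : X) (y : Y) (z : Z) :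
    ‖∑ l, f l x * g l y * h l z‖ ≤ ‖∑ l, Tensor.tmul (f l) (g l) (h l)‖ := by
  let r := (pointRepresentation x, pointRepresentation y, pointRepresentation z)
  have h1 : ∀ l, evalHom r (Tensor.tmul (f l) (g l) (h l)) = (f l x * g l y * h l z) • 1 :=
    fun l => by
      rw [evalHom_tmul, tensorOperator, pointRepresentation_apply, pointRepresentation_apply,
        pointRepresentation_apply]
      refine (HilbertTensor.smul_map _ _ _ _).trans ?_
      rw [HilbertTensor.map_smul_map, HilbertTensor.map_smul, HilbertTensor.map_one, smul_smul,
        smul_smul]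
      rfl
  refine le_trans (le_of_eq ?_) (norm_starAlgHom_le (evalHom r) _)
  rw [map_sum, Finset.sum_congr rfl fun l _ => h1 l, ← Finset.sum_smul, norm_smul, norm_one,
    mul_one]

namespace Tensor

section Kernel

variable {X Y Z T : Type u} [TopologicalSpace X] [CompactSpace X] [T2Space X]
  [TopologicalSpace Y] [CompactSpace Y] [T2Space Y] [TopologicalSpace Z] [CompactSpace Z]
  [CStarAlgebra T]

theorem mem_of_map_right_eq_zero (σ : T →⋆ₐ[ℂ] C(Z, ℂ)) (hσ : Function.Surjective σ)
    (M : Submodule ℂ (Tensor C(X, ℂ) C(Y, ℂ) T))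
    (hM : IsClosed (M : Set (Tensor C(X, ℂ) C(Y, ℂ) T)))
    (hmem : ∀ f g c, σ c = 0 → tmul f g c ∈ M) (d : Tensor C(X, ℂ) C(Y, ℂ) T)
    (hd : map (StarAlgHom.id ℂ _) (StarAlgHom.id ℂ _) σ d = 0) : d ∈ M := by
  have hprod : ∀ f g c, inclLeft C(X, ℂ) C(Y, ℂ) T f * inclMiddle C(X, ℂ) C(Y, ℂ) T g *
      inclRight C(X, ℂ) C(Y, ℂ) T c = tmul f g c := fun f g c => by
    change tmul f 1 1 * tmul 1 g 1 * tmul 1 1 c = tmul f g c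
    simp [← tmul_mul_tmul]
  refine mem_of_map_eq_zero σ hσ (inclLeft _ _ _) (inclMiddle _ _ _) (inclRight _ _ _)
    (fun f g => ?_) (fun f c => ?_) (fun g c => ?_) ?_ _ (fun n f g c x y z => ?_) M hM
    (fun f g c hc => ?_) d hd
  · change tmul f 1 1 * tmul 1 g 1 = tmul 1 g 1 * tmul f 1 1
    simp [← tmul_mul_tmul]
  · change tmul f 1 1 * tmul 1 1 c = tmul 1 1 c * tmul f 1 1
    simp [← tmul_mul_tmul]
  · change tmul 1 g 1 * tmul 1 1 c = tmul 1 1 c * tmul 1 g 1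
    simp [← tmul_mul_tmul]
  · simp_rw [hprod]
    exact dense_span_tmul _ _ _
  · simp_rw [hprod, map_sum, map_tmul]
    exact norm_sum_apply_le n f g (fun l => σ (c l)) x y z
  · rw [hprod]
    exact hmem f g c hc

theorem mem_of_map_middle_eq_zero (σ : T →⋆ₐ[ℂ] C(Z, ℂ)) (hσ : Function.Surjective σ)
    (M : Submodule ℂ (Tensor C(X, ℂ) T C(Y, ℂ)))
    (hM : IsClosed (M : Set (Tensor C(X, ℂ) T C(Y, ℂ))))
    (hmem : ∀ f c g, σ c = 0 → tmul f c g ∈ M) (d : Tensor C(X, ℂ) T C(Y, ℂ))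
    (hd : map (StarAlgHom.id ℂ _) σ (StarAlgHom.id ℂ _) d = 0) : d ∈ M := by
  have hprod : ∀ f g c, inclLeft C(X, ℂ) T C(Y, ℂ) f * inclRight C(X, ℂ) T C(Y, ℂ) g *
      inclMiddle C(X, ℂ) T C(Y, ℂ) c = tmul f c g := fun f g c => by
    change tmul f 1 1 * tmul 1 1 g * tmul 1 c 1 = tmul f c g
    simp [← tmul_mul_tmul]
  refine mem_of_map_eq_zero σ hσ (inclLeft _ _ _) (inclRight _ _ _) (inclMiddle _ _ _)
    (fun f g => ?_) (fun f c => ?_) (fun g c => ?_) ?_ _ (fun n f g c x y z => ?_) M hM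
    (fun f g c hc => ?_) d hd
  · change tmul f 1 1 * tmul 1 1 g = tmul 1 1 g * tmul f 1 1
    simp [← tmul_mul_tmul]
  · change tmul f 1 1 * tmul 1 c 1 = tmul 1 c 1 * tmul f 1 1
    simp [← tmul_mul_tmul]
  · change tmul 1 1 g * tmul 1 c 1 = tmul 1 c 1 * tmul 1 1 g
    simp [← tmul_mul_tmul]
  · simp_rw [hprod]
    -- The same set of elementary tensors, with the factors quantified in a different order.
    convert dense_span_tmul C(X, ℂ) T C(Y, ℂ) using 5
    exact exists_congr fun f => exists_comm
  · simp_rw [hprod, map_sum, map_tmul]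
    refine le_trans (le_of_eq ?_) (norm_sum_apply_le n f (fun l => σ (c l)) g x z y)
    refine congrArg norm (Finset.sum_congr rfl fun l _ => ?_)
    ring
  · rw [hprod]
    exact hmem f c g hc

theorem mem_of_map_left_eq_zero (σ : T →⋆ₐ[ℂ] C(Z, ℂ)) (hσ : Function.Surjective σ)
    (M : Submodule ℂ (Tensor T C(X, ℂ) C(Y, ℂ)))
    (hM : IsClosed (M : Set (Tensor T C(X, ℂ) C(Y, ℂ))))
    (hmem : ∀ c f g, σ c = 0 → tmul c f g ∈ M) (d : Tensor T C(X, ℂ) C(Y, ℂ))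
    (hd : map σ (StarAlgHom.id ℂ _) (StarAlgHom.id ℂ _) d = 0) : d ∈ M := by
  have hprod : ∀ f g c, inclMiddle T C(X, ℂ) C(Y, ℂ) f * inclRight T C(X, ℂ) C(Y, ℂ) g *
      inclLeft T C(X, ℂ) C(Y, ℂ) c = tmul c f g := fun f g c => by
    change tmul 1 f 1 * tmul 1 1 g * tmul c 1 1 = tmul c f g
    simp [← tmul_mul_tmul]
  refine mem_of_map_eq_zero σ hσ (inclMiddle _ _ _) (inclRight _ _ _) (inclLeft _ _ _)
    (fun f g => ?_) (fun f c => ?_) (fun g c => ?_) ?_ _ (fun n f g c x y z => ?_) M hM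
    (fun f g c hc => ?_) d hd
  · change tmul 1 f 1 * tmul 1 1 g = tmul 1 1 g * tmul 1 f 1
    simp [← tmul_mul_tmul]
  · change tmul 1 f 1 * tmul c 1 1 = tmul c 1 1 * tmul 1 f 1
    simp [← tmul_mul_tmul]
  · change tmul 1 1 g * tmul c 1 1 = tmul c 1 1 * tmul 1 1 g
    simp [← tmul_mul_tmul]
  · simp_rw [hprod]
    convert dense_span_tmul T C(X, ℂ) C(Y, ℂ) using 5
    exact (exists_congr fun f => exists_comm).trans exists_comm
  · simp_rw [hprod, map_sum, map_tmul]
    refine le_trans (le_of_eq ?_) (norm_sum_apply_le n (fun l => σ (c l)) f g z x y)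
    refine congrArg norm (Finset.sum_congr rfl fun l _ => ?_)
    ring
  · rw [hprod]
    exact hmem c f g hc

end Kernel

/-- Definitional, since both sides evaluate `x` at the same pulled-back representations. -/
theorem map_map {A B C A' B' C' A'' B'' C'' : Type u} [CStarAlgebra A] [CStarAlgebra B]
    [CStarAlgebra C] [CStarAlgebra A'] [CStarAlgebra B'] [CStarAlgebra C'] [CStarAlgebra A'']
    [CStarAlgebra B''] [CStarAlgebra C''] (f : A →⋆ₐ[ℂ] A') (g : B →⋆ₐ[ℂ] B')
    (h : C →⋆ₐ[ℂ] C') (f' : A' →⋆ₐ[ℂ] A'') (g' : B' →⋆ₐ[ℂ] B'') (h' : C' →⋆ₐ[ℂ] C'')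
    (x : Tensor A B C) :
    map f' g' h' (map f g h x) = map (f'.comp f) (g'.comp g) (h'.comp h) x := rfl

theorem tmul_eq_zero_of_left {A B C : Type u} [CStarAlgebra A] [CStarAlgebra B] [CStarAlgebra C]
    (b : B) (c : C) : tmul (0 : A) b c = 0 := by simpa using smul_tmul 0 (0 : A) b c

theorem tmul_eq_zero_of_middle {A B C : Type u} [CStarAlgebra A] [CStarAlgebra B]
    [CStarAlgebra C] (a : A) (c : C) : tmul a (0 : B) c = 0 := by
  simpa using tmul_smul_tmul 0 a (0 : B) c

theorem tmul_eq_zero_of_right {A B C : Type u} [CStarAlgebra A] [CStarAlgebra B]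
    [CStarAlgebra C] (a : A) (b : B) : tmul a b (0 : C) = 0 := by
  simpa using tmul_smul 0 a b (0 : C)

end Tensor

/-! ### Lifting kernel elements through the symbol maps -/

/-- The image under `f` of the elements which `g` maps to a scalar. -/
def imageOfScalar {A B B' : Type*} [CStarAlgebra A] [CStarAlgebra B] [CStarAlgebra B']
    (f : A →⋆ₐ[ℂ] B) (g : A →⋆ₐ[ℂ] B') : Submodule ℂ B :=
  ((StarAlgHom.ofId ℂ B').range.comap g).toSubalgebra.toSubmodule.map f.toAlgHom.toLinearMap

theorem mem_imageOfScalar {A B B' : Type*} [CStarAlgebra A] [CStarAlgebra B] [CStarAlgebra B']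
    {f : A →⋆ₐ[ℂ] B} {g : A →⋆ₐ[ℂ] B'} {x : B} :
    x ∈ imageOfScalar f g ↔ ∃ a, (∃ t : ℂ, algebraMap ℂ B' t = g a) ∧ f a = x := Iff.rfl

/-- Scalars are allowed instead of only `g a = 0` so that the domain is a unital C*-algebra and the
closed range theorem for unital *-homomorphisms applies. -/
theorem isClosed_imageOfScalar {A B B' : Type*} [CStarAlgebra A] [CStarAlgebra B]
    [CStarAlgebra B'] (f : A →⋆ₐ[ℂ] B) (g : A →⋆ₐ[ℂ] B') :
    IsClosed (imageOfScalar f g : Set B) := by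
  let E : StarSubalgebra ℂ A := (StarAlgHom.ofId ℂ B').range.comap g
  have hE : IsClosed (E : Set A) :=
    (isClosed_range_starAlgHom (StarAlgHom.ofId ℂ B')).preimage (continuous_starAlgHom g)
  let _ : CStarAlgebra E := StarSubalgebra.cstarAlgebra E (h_closed := hE)
  convert isClosed_range_starAlgHom (f.comp E.subtype) using 1
  ext x
  constructor
  · rintro ⟨a, ha, rfl⟩
    exact ⟨⟨a, ha⟩, rfl⟩
  · rintro ⟨⟨a, ha⟩, rfl⟩
    exact ⟨a, ha, rfl⟩

theorem factorMap_comp : ∀ (b c d : Bool) (h : b = true → c = true) (h' : c = true → d = true)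
    (h'' : b = true → d = true),
    (factorMap c d h').comp (factorMap b c h) = factorMap b d h''
  | true, true, true, _, _, _ => rfl
  | false, false, false, _, _, _ => rfl
  | false, false, true, _, _, _ => rfl
  | false, true, true, _, _, _ => rfl
  | true, false, _, h, _, _ => absurd (h rfl) Bool.false_ne_true
  | _, true, false, _, h, _ => absurd (h rfl) Bool.false_ne_true

theorem factorMap_injective_of_eq :
    ∀ (b c : Bool) (h : b = true → c = true), b = c → Function.Injective (factorMap b c h)
  | true, true, _, _ => Function.injective_id
  | false, false, _, _ => Function.injective_id
  | false, true, _, h => absurd h Bool.false_ne_true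
  | true, false, _, h => absurd h.symm Bool.false_ne_true

theorem factorMap_factorMap (b c d : Bool) (h : b = true → c = true)
    (h' : c = true → d = true) (x : Factor b) :
    factorMap c d h' (factorMap b c h x) = factorMap b d (h' ∘ h) x :=
  DFunLike.congr_fun (factorMap_comp b c d h h' (h' ∘ h)) x

theorem factorTensorMap_factorTensorMap (p q r : Fin 3 → Bool) (h : ∀ l, p l = true → q l = true)
    (h' : ∀ l, q l = true → r l = true) (x : FactorTensor p) :
    factorTensorMap q r h' (factorTensorMap p q h x) =
      factorTensorMap p r (fun l => h' l ∘ h l) x := by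
  rw [factorTensorMap, factorTensorMap, Tensor.map_map, factorMap_comp _ _ _ _ _ (h' 0 ∘ h 0),
    factorMap_comp _ _ _ _ _ (h' 1 ∘ h 1), factorMap_comp _ _ _ _ _ (h' 2 ∘ h 2)]
  rfl

/-- The Booleans are variables with equations so that, after substitution, the two outer maps become
identities of `C(S¹)` definitionally. -/
theorem mem_of_factorMap_left_eq_zero (b₀ b₁ b₂ : Bool) (h₁ : b₁ = true) (h₂ : b₂ = true)
    (M : Submodule ℂ (Tensor (Factor b₀) (Factor b₁) (Factor b₂)))
    (hM : IsClosed (M : Set (Tensor (Factor b₀) (Factor b₁) (Factor b₂))))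
    (hmem : ∀ (x₀ : Factor b₀) (x₁ : Factor b₁) (x₂ : Factor b₂),
      factorMap b₀ true (fun _ => rfl) x₀ = 0 → Tensor.tmul x₀ x₁ x₂ ∈ M)
    (d : Tensor (Factor b₀) (Factor b₁) (Factor b₂))
    (hd : Tensor.map (factorMap b₀ true fun _ => rfl) (factorMap b₁ true fun _ => rfl)
      (factorMap b₂ true fun _ => rfl) d = 0) : d ∈ M := by
  subst h₁ h₂
  exact Tensor.mem_of_map_left_eq_zero (X := ULift.{1} Circle) (Y := ULift.{1} Circle)
    (Z := ULift.{1} Circle) (T := Factor b₀) (factorMap b₀ true fun _ => rfl)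
    (factorMap_surjective _ _ _) M hM hmem d hd

theorem mem_of_factorMap_middle_eq_zero (b₀ b₁ b₂ : Bool) (h₀ : b₀ = true) (h₂ : b₂ = true)
    (M : Submodule ℂ (Tensor (Factor b₀) (Factor b₁) (Factor b₂)))
    (hM : IsClosed (M : Set (Tensor (Factor b₀) (Factor b₁) (Factor b₂))))
    (hmem : ∀ (x₀ : Factor b₀) (x₁ : Factor b₁) (x₂ : Factor b₂),
      factorMap b₁ true (fun _ => rfl) x₁ = 0 → Tensor.tmul x₀ x₁ x₂ ∈ M)
    (d : Tensor (Factor b₀) (Factor b₁) (Factor b₂))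
    (hd : Tensor.map (factorMap b₀ true fun _ => rfl) (factorMap b₁ true fun _ => rfl)
      (factorMap b₂ true fun _ => rfl) d = 0) : d ∈ M := by
  subst h₀ h₂
  exact Tensor.mem_of_map_middle_eq_zero (X := ULift.{1} Circle) (Y := ULift.{1} Circle)
    (Z := ULift.{1} Circle) (T := Factor b₁) (factorMap b₁ true fun _ => rfl)
    (factorMap_surjective _ _ _) M hM hmem d hd

theorem mem_of_factorMap_right_eq_zero (b₀ b₁ b₂ : Bool) (h₀ : b₀ = true) (h₁ : b₁ = true)
    (M : Submodule ℂ (Tensor (Factor b₀) (Factor b₁) (Factor b₂)))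
    (hM : IsClosed (M : Set (Tensor (Factor b₀) (Factor b₁) (Factor b₂))))
    (hmem : ∀ (x₀ : Factor b₀) (x₁ : Factor b₁) (x₂ : Factor b₂),
      factorMap b₂ true (fun _ => rfl) x₂ = 0 → Tensor.tmul x₀ x₁ x₂ ∈ M)
    (d : Tensor (Factor b₀) (Factor b₁) (Factor b₂))
    (hd : Tensor.map (factorMap b₀ true fun _ => rfl) (factorMap b₁ true fun _ => rfl)
      (factorMap b₂ true fun _ => rfl) d = 0) : d ∈ M := by
  subst h₀ h₁
  exact Tensor.mem_of_map_right_eq_zero (X := ULift.{1} Circle) (Y := ULift.{1} Circle)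
    (Z := ULift.{1} Circle) (T := Factor b₂) (factorMap b₂ true fun _ => rfl)
    (factorMap_surjective _ _ _) M hM hmem d hd

theorem mem_of_factorTensorMap_eq_zero (q : Fin 3 → Bool) (k : Fin 3)
    (hq : ∀ l, l ≠ k → q l = true) (M : Submodule ℂ (FactorTensor q))
    (hM : IsClosed (M : Set (FactorTensor q)))
    (hmem : ∀ x : ∀ l, Factor (q l), factorMap (q k) true (fun _ => rfl) (x k) = 0 →
      Tensor.tmul (x 0) (x 1) (x 2) ∈ M) (d : FactorTensor q)
    (hd : factorTensorMap q (fun _ => true) (fun _ _ => rfl) d = 0) : d ∈ M := by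
  fin_cases k
  · exact mem_of_factorMap_left_eq_zero _ _ _ (hq 1 (by decide)) (hq 2 (by decide)) M hM
      (fun x₀ x₁ x₂ h => hmem (fun
        | 0 => x₀
        | 1 => x₁
        | 2 => x₂) h) d hd
  · exact mem_of_factorMap_middle_eq_zero _ _ _ (hq 0 (by decide)) (hq 2 (by decide)) M hM
      (fun x₀ x₁ x₂ h => hmem (fun
        | 0 => x₀
        | 1 => x₁
        | 2 => x₂) h) d hd
  · exact mem_of_factorMap_right_eq_zero _ _ _ (hq 0 (by decide)) (hq 1 (by decide)) M hM
      (fun x₀ x₁ x₂ h => hmem (fun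
        | 0 => x₀
        | 1 => x₁
        | 2 => x₂) h) d hd

/-- Evaluation at a point of the torus shows that the unit has norm at least `1`. -/
instance instNontrivialFactorTensor : Nontrivial (FactorTensor fun _ => true) := by
  refine ⟨1, 0, fun h => ?_⟩
  have h1 := Tensor.norm_sum_apply_le 1 (fun _ => (1 : CircleAlgebra)) (fun _ => (1 : CircleAlgebra))
    (fun _ => (1 : CircleAlgebra)) ⟨1⟩ ⟨1⟩ ⟨1⟩
  have h2 : (Tensor.tmul 1 1 1 : Tensor CircleAlgebra CircleAlgebra CircleAlgebra) = 0 :=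
    Tensor.one_tmul.trans h
  simp [h2] at h1
  linarith

/-- This is `ker(A_{ij} → D) ⊆ π^i_j(ker π^i_k)`, with `p`, `q`, `q'` describing `A_i`, `A_{ij}`,
`A_{ik}`. It suffices to lift elementary tensors with factor at `k` in `ker σ`, because the image is
closed. -/
theorem exists_lift_of_factorTensorMap_eq_zero (p q q' : Fin 3 → Bool)
    (h : ∀ l, p l = true → q l = true) (h' : ∀ l, p l = true → q' l = true) (k : Fin 3)
    (hq : ∀ l, l ≠ k → q l = true) (hpk : p k = q k) (hk : q' k = true) (x : FactorTensor q)
    (hx : factorTensorMap q (fun _ => true) (fun _ _ => rfl) x = 0) :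
    ∃ y, factorTensorMap p q h y = x ∧ factorTensorMap p q' h' y = 0 := by
  have hmem : x ∈ imageOfScalar (factorTensorMap p q h) (factorTensorMap p q' h') := by
    refine mem_of_factorTensorMap_eq_zero q k hq _ (isClosed_imageOfScalar _ _)
      (fun x hxk => ?_) x hx
    choose y hy using fun l => factorMap_surjective (p l) (q l) (h l) (x l)
    -- The factor at `k` of the target `q'` is already `C(S¹)`, so vanishing there can be tested
    -- after the identity map to `C(S¹)`.
    have hyk : factorMap (p k) (q' k) (h' k) (y k) = 0 := by
      refine factorMap_injective_of_eq (q' k) true (fun _ => rfl) hk ?_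
      rw [factorMap_factorMap, map_zero, ← hxk, ← hy, factorMap_factorMap]
    refine mem_imageOfScalar.2 ⟨Tensor.tmul (y 0) (y 1) (y 2), ⟨0, ?_⟩, ?_⟩
    · rw [map_zero, factorTensorMap, Tensor.map_tmul]
      symm
      fin_cases k
      · rw [show factorMap (p 0) (q' 0) (h' 0) (y 0) = 0 from hyk]
        exact Tensor.tmul_eq_zero_of_left _ _
      · rw [show factorMap (p 1) (q' 1) (h' 1) (y 1) = 0 from hyk]
        exact Tensor.tmul_eq_zero_of_middle _ _
      · rw [show factorMap (p 2) (q' 2) (h' 2) (y 2) = 0 from hyk]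
        exact Tensor.tmul_eq_zero_of_right _ _
    · rw [factorTensorMap, Tensor.map_tmul, hy, hy, hy]
  obtain ⟨y, ⟨t, ht⟩, rfl⟩ := mem_imageOfScalar.1 hmem
  refine ⟨y, rfl, ?_⟩
  rw [factorTensorMap_factorTensorMap] at hx
  have h1 := factorTensorMap_factorTensorMap p q' (fun _ => true) h' (fun _ _ => rfl) y
  rw [← ht, AlgHomClass.commutes] at h1
  -- The scalar allowed by `imageOfScalar` survives in the nonzero algebra `D`, where the image of
  -- `y` is that of `x`, namely `0`.
  have ht0 : t = 0 := (map_eq_zero (algebraMap ℂ (FactorTensor fun _ => true))).1 (h1.trans hx)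
  rw [← ht, ht0, map_zero]

/-! ### The cocycle condition from a common target -/

namespace SurjectiveFamily

variable {J : Type u} [Finite J] (F : SurjectiveFamily.{u, v} J) {i j k : J} {D : Type w}
  [CStarAlgebra D]

theorem transition_mk (hij : i ≠ j) (hik : i ≠ k) (hjk : j ≠ k)
    (h : F.leftImage hij hik = F.rightImage hij hjk) (b : F.source j) (a : F.source i)
    (hab : F.projLeft hij a - F.projRight hij b ∈ F.leftImage hij hik) :
    F.transition hij hik hjk h (Ideal.Quotient.mk _ b) = Ideal.Quotient.mk _ a := by
  change (F.leftEquiv hij hik).symm (Ideal.Quotient.mk _ (F.projRight hij b)) = _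
  rw [AlgEquiv.symm_apply_eq]
  change _ = Ideal.Quotient.mk _ (F.projLeft hij a)
  rw [eq_comm, Ideal.Quotient.eq]
  exact hab

/-- If the algebras `A_{ij}` have compatible maps to one algebra `D`, and if
`ker(A_{ij} → D) ⊆ π^i_j(ker π^i_k)`, then the cocycle condition holds. -/
theorem cocycleCondition_of_lift (θ : ∀ i, F.source i →⋆ₐ[ℂ] D) (τ : ∀ e, F.target e →⋆ₐ[ℂ] D)
    (hτ : ∀ e i he hi a, τ e (F.proj e i he hi a) = θ i a)
    (hlift : ∀ e e' i he hi he' hi', e ≠ e' → ∀ x, τ e x = 0 →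
      ∃ y, F.proj e i he hi y = x ∧ F.proj e' i he' hi' y = 0) : F.CocycleCondition := by
  -- Both ideals are identified with the kernel of `τ s(i, j)`. The index `k` must differ from `j`
  -- for `hlift` to apply to two different pairs.
  have hleft : ∀ (i j k : J) (hij : i ≠ j) (hik : i ≠ k) (_ : j ≠ k) x,
      x ∈ F.leftImage hij hik ↔ τ s(i, j) x = 0 := by
    intro i j k hij hik hjk x
    constructor
    · rintro ⟨y, hy, rfl⟩
      have hy' : F.projLeft hik y = 0 := hy
      refine (hτ _ i _ _ y).trans ((hτ s(i, k) i (by simpa using hik)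
        (Sym2.mem_mk_left i k) y).symm.trans ?_)
      exact (congrArg _ hy').trans (map_zero _)
    · intro hx
      obtain ⟨y, hy, hy'⟩ := hlift s(i, j) s(i, k) i (by simpa using hij) (Sym2.mem_mk_left i j)
        (by simpa using hik) (Sym2.mem_mk_left i k) (fun h => hjk (Sym2.congr_right.1 h)) x hx
      exact ⟨y, hy', hy⟩
  have hright : ∀ (i j k : J) (hij : i ≠ j) (_ : i ≠ k) (hjk : j ≠ k) x,
      x ∈ F.rightImage hij hjk ↔ τ s(i, j) x = 0 := by
    intro i j k hij hik hjk x
    constructor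
    · rintro ⟨y, hy, rfl⟩
      have hy' : F.projLeft hjk y = 0 := hy
      refine (hτ _ j _ _ y).trans ((hτ s(j, k) j (by simpa using hjk)
        (Sym2.mem_mk_left j k) y).symm.trans ?_)
      exact (congrArg _ hy').trans (map_zero _)
    · intro hx
      obtain ⟨y, hy, hy'⟩ := hlift s(i, j) s(j, k) j (by simpa using hij) (Sym2.mem_mk_right i j)
        (by simpa using hjk) (Sym2.mem_mk_left j k)
        (fun h => hik (Sym2.congr_right.1 (Sym2.eq_swap.trans h))) x hx
      exact ⟨y, hy', hy⟩
  refine ⟨fun i j k hij hik hjk => Ideal.ext fun x =>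
    (hleft i j k hij hik hjk x).trans (hright i j k hij hik hjk x).symm, ?_⟩
  intro i j k hij hik hjk x
  -- If `a` and `b` agree in `D`, then the difference of their images in `A_{ij}` lies in the kernel
  -- of `τ`, which is the ideal divided out.
  have htransition : ∀ (i j k : J) (hij : i ≠ j) (hik : i ≠ k) (hjk : j ≠ k) (h) (b : F.source j)
      (a : F.source i), θ i a = θ j b →
      F.transition hij hik hjk h (Ideal.Quotient.mk _ b) = Ideal.Quotient.mk _ a := by
    intro i j k hij hik hjk h b a hab
    refine F.transition_mk hij hik hjk h b a ((hleft i j k hij hik hjk _).2 ?_)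
    rw [map_sub, projLeft, projRight, hτ, hτ, hab, sub_self]
  have hex : ∀ (i j : J) (_ : i ≠ j) (b : F.source j), ∃ a : F.source i, θ i a = θ j b := by
    intro i j hij b
    obtain ⟨a, ha⟩ := F.surjective_projLeft hij (F.projRight hij b)
    refine ⟨a, (hτ s(i, j) i (by simpa using hij) (Sym2.mem_mk_left i j) a).symm.trans ?_⟩
    exact (congrArg _ ha).trans (hτ _ _ _ _ _)
  obtain ⟨c, rfl⟩ := Ideal.Quotient.mk_surjective x
  -- Representatives `c`, `b`, `a` with one common image in `D` compute all three transition maps at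
  -- once; `swap` does not change representatives.
  obtain ⟨b, hb⟩ := hex j k hjk c
  obtain ⟨a, ha⟩ := hex i j hij b
  rw [htransition i k j hik hij hjk.symm _ c a (ha.trans hb)]
  simp only [swap, Ideal.quotientEquivAlgOfEq_mk]
  rw [htransition j k i hjk hij.symm hik.symm _ c b hb, Ideal.quotientEquivAlgOfEq_mk,
    htransition i j k hij hik hjk _ b a ha]

end SurjectiveFamily

/-- Writing `e = {i, j}` and `e' = {i, k}`, the three indices are distinct and so exhaust `Fin 3`.
-/
theorem exists_third_of_mem {e e' : Sym2 (Fin 3)} {i : Fin 3} (he : ¬ e.IsDiag) (hi : i ∈ e)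
    (he' : ¬ e'.IsDiag) (hi' : i ∈ e') (h : e ≠ e') :
    ∃ k, (∀ l, l ≠ k → l ∈ e) ∧ k ∉ e ∧ k ∈ e' := by
  obtain ⟨j, rfl⟩ := hi
  obtain ⟨k, rfl⟩ := hi'
  have hjk : j ≠ k := fun hjk => h (by rw [hjk])
  simp only [Sym2.mk_isDiag_iff] at he he'
  refine ⟨k, ?_, ?_, Sym2.mem_mk_right i k⟩
  · intro l hl
    rw [Sym2.mem_iff]
    omega
  · rw [Sym2.mem_iff]
    rintro (rfl | rfl)
    · exact he' rfl
    · exact hjk rfl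

end HeegaardSphere

end

theorem lemma3p1 : HeegaardSphere.sphereFamily.CocycleCondition := by
  refine HeegaardSphere.sphereFamily.cocycleCondition_of_lift
    (D := HeegaardSphere.FactorTensor fun _ => true)
    (fun i => HeegaardSphere.factorTensorMap (fun l => decide (l = i)) _ fun _ _ => rfl)
    (fun e => HeegaardSphere.factorTensorMap (fun l => decide (l ∈ e)) _ fun _ _ => rfl)
    (fun e i he hi a => HeegaardSphere.factorTensorMap_factorTensorMap
      (fun l => decide (l = i)) (fun l => decide (l ∈ e)) (fun _ => true)
      (fun l hl => decide_eq_true (of_decide_eq_true hl ▸ hi)) _ a) ?_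
  intro e e' i he hi he' hi' hee' x hx
  obtain ⟨k, hk, hke, hke'⟩ := HeegaardSphere.exists_third_of_mem he hi he' hi' hee'
  refine HeegaardSphere.exists_lift_of_factorTensorMap_eq_zero (fun l => decide (l = i))
    (fun l => decide (l ∈ e)) (fun l => decide (l ∈ e'))
    (fun l hl => decide_eq_true (of_decide_eq_true hl ▸ hi))
    (fun l hl => decide_eq_true (of_decide_eq_true hl ▸ hi')) k
    (fun l hl => decide_eq_true (hk l hl)) ?_ (decide_eq_true hke') x hx
  -- The factor at `k` is `𝒯` both in `A_i` and in the target of `e`, as `k ∉ e` forces `k ≠ i`.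
  rw [decide_eq_false hke, decide_eq_false]
  rintro rfl
  exact hke hi
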